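/- \textbf{Model.} Consider the Gaussian crossed effect model with two factors with $I$ levels each: for $n=1,\dots,N$, $y_n\sim N(a^{(0)}+a^{(1)}_{i_1[n]}+a^{(2)}_{i_2[n]},\tau^{-1})$ independently, with independent priors $a^{(k)}_i\sim N(0,\tau_k^{-1})$ ($k=1,2$, $1\le i\le I$) and $a^{(0)}\sim N(\mu_{pr},T_{pr}^{-1})$, where $\tau,\tau_1,\tau_2>0$ and $T_{pr}\ge 0$ ($T_{pr}=0$ meaning a flat prior). Let $n_{ij}$ be the number of observations with $i_1[n]=i$ and $i_2[n]=j$, $p=2I$ the number of factor levels, and $\bar n=2N/p$. Let $Q$ be the posterior precision matrix of $\theta=(a^{(1)}_1,\dots,a^{(1)}_I,a^{(2)}_1,\dots,a^{(2)}_I,a^{(0)})$, in this order, and $M=2I+1$. \textbf{Sparse linear algebra.} Let $G_Q$ be the graph on $\{1,\dots,M\}$ with an edge between $i\ne j$ iff $Q_{ij}\neq0$, and $n_Q$ the number of non-zero entries of the lower triangular part of $Q$ (with the diagonal). For $m\le j$ the entry $L_{jm}$ of the Cholesky factor is a potential non-zero if some path from $m$ to $j$ in $G_Q$ avoids $\{m+1,\dots,M\}\setminus\{j\}$;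 $n_L$ is the number of potential non-zeros. $Cost(SLA)$ is the number of flops used by the columnwise recursion $L_{mm}=(Q_{mm}-\sum_{\ell<m}L_{m\ell}^2)^{1/2}$, $L_{jm}=L_{mm}^{-1}(Q_{jm}-\sum_{\ell<m}L_{m\ell}L_{j\ell})$ ($j>m$), when entries that are not potential non-zeros are neither computed nor used. \textbf{Gibbs sampler.} One iteration of the collapsed Gibbs sampler redraws $(a^{(0)},a^{(1)})$ from its posterior law given $a^{(2)}$, and then $(a^{(0)},a^{(2)})$ from its posterior law given $a^{(1)}$. $Cost(Gibbs)$ is the cost per iteration times the relaxation time $(1-\rho)^{-1}$. Here $\rho$ is the $L^2$-rate of convergence with respect to the posterior law $\pi$, i.e. the infimum of the $r\geq 0$ such that $\|P^tf-\pi f\|_{L^2(\pi)}=O(r^t)$ for every $f\in L^2(\pi)$, $P$ being the transition operator of one iteration. The cost per iteration is the number of elementary operations (arithmetic operations, square roots, standard normal draws) of the implementation that, for each factor $k$ in turn, accumulates the counts and residual sums of the levels of factor $k$ in one pass through the data, draws $a^{(0)}$ from its (normal) posterior law given the effects of the other factor, and then draws each $a^{(k)}_i$ from its (normal) posterior law given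 $a^{(0)}$ and the effects of the other factor. \textbf{Design.} Given integers $d\ge2$ and $I\ge d+1$, let $n_{ij}=1$ for $1\le i\le I-1$ if (a) $i=j$, or (b) $i<j$ and $j-2$ is congruent modulo $I-1$ to an integer in $[d(i-1),di)$, or (c) $i>j$ and $j-1$ is congruent modulo $I-1$ to an integer in $[d(i-1),di)$; and $n_{ij}=0$ otherwise. Let $n_{Ij}=1$ if $\sum_{i=1}^{I-1}n_{ij}\le d$ and $n_{Ij}=0$ otherwise. \textbf{Claim.} There are absolute constants $c,C>0$ and, for all $\tau,\tau_1,\tau_2>0$, a constant $C_\gamma>0$ depending only on $(\tau,\tau_1,\tau_2)$ such that, for all $d\ge 2$, $I\ge d+1$, $T_{pr}\ge0$, $\mu_{pr}$, and all data with the above design: the design has balanced levels, i.e. every level of each factor has exactly $N/I$ observations, and $\bar n=d+1$; $$c\,p\bar n\le n_Q\le C\,p\bar n,\qquad c\,p^2\le n_L\le C\,p^2,\qquad c\,p^3\le Cost(SLA)\le C\,p^3;$$ the implementation above draws exactly from the conditional laws that define the sampler; and $$Cost(Gibbs)\le C_\gamma\,p\,\bar n^2 .$$ In particular, none of the constants depends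 on $N$ or $d$. -/

import Mathlib

open MeasureTheory ProbabilityTheory
open scoped ENNReal NNReal

noncomputable section

namespace CrossedEffects

/-! ### Computations with an operation counter -/

/-- A value together with the number of elementary operations spent on computing it. -/
structure Counted (α : Type) where
  val : α
  ops : ℕ

instance : Monad Counted where
  pure a := ⟨a, 0⟩
  bind x f := ⟨(f x.val).val, x.ops + (f x.val).ops⟩

/-- One elementary operation (an arithmetic operation, a square root, or one draw from `N(0,1)`)
with result `a`. -/
def op {α : Type} (a : α) : Counted α := ⟨a, 1⟩

/-! ### Sparse Cholesky factorization -/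

/-- The conditional independence graph of a Gaussian vector with precision matrix `Q`. -/
def condIndepGraph {M : ℕ} (Q : Matrix (Fin M) (Fin M) ℝ) : SimpleGraph (Fin M) :=
  SimpleGraph.fromRel fun i j => Q i j ≠ 0

/-- The future set `{m+1, …, M}` of `m`, with `j` left out, separates `m` from `j`: every walk from
`m` to `j` meets it. -/
def FutureSeparates {M : ℕ} (G : SimpleGraph (Fin M)) (m j : Fin M) : Prop :=
  ∀ w : G.Walk m j, ∃ v ∈ w.support, m < v ∧ v ≠ j

/-- The entry `L j m`, `m ≤ j`, of the Cholesky factor is a potential non-zero. -/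
def PotentialNonzero {M : ℕ} (G : SimpleGraph (Fin M)) (j m : Fin M) : Prop :=
  m ≤ j ∧ ¬ FutureSeparates G m j

open Classical in
/-- Number of potential non-zeros in the `m`-th column of the Cholesky factor. -/
def nLcol {M : ℕ} (Q : Matrix (Fin M) (Fin M) ℝ) (m : Fin M) : ℕ :=
  (Finset.univ.filter fun j => PotentialNonzero (condIndepGraph Q) j m).card

/-- Number of potential non-zeros in the Cholesky factor of `Q`. -/
def nL {M : ℕ} (Q : Matrix (Fin M) (Fin M) ℝ) : ℕ := ∑ m, nLcol Q m

open Classical in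
/-- Number of non-zeros in the lower triangular part (diagonal included) of `Q`. -/
def nQ {M : ℕ} (Q : Matrix (Fin M) (Fin M) ℝ) : ℕ :=
  (Finset.univ.filter fun x : Fin M × Fin M => x.2 ≤ x.1 ∧ Q x.1 x.2 ≠ 0).card

open Classical in
/-- Computation of the entry `L j m` (`m ≤ j`) from the earlier columns and, if `m < j`, from
`L m m`:
`L m m = √(Q m m - ∑ ℓ < m, L m ℓ ^ 2)` and `L j m = (Q j m - ∑ ℓ < m, L m ℓ * L j ℓ) / L m m`.
Products with an entry that is not a potential non-zero are skipped. -/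
def choleskyEntry {M : ℕ} (Q : Matrix (Fin M) (Fin M) ℝ) (L : Matrix (Fin M) (Fin M) ℝ)
    (j m : Fin M) : Counted ℝ := do
  let G := condIndepGraph Q
  let terms := (List.finRange M).filter fun l =>
    decide (l < m ∧ PotentialNonzero G m l ∧ PotentialNonzero G j l)
  let s ← terms.foldlM (fun (acc : ℝ) l => do
    let t ← op (L m l * L j l)
    op (acc - t)) (Q j m)
  if j = m then op (Real.sqrt s) else op (s / L m m)

open Classical in
/-- Column `m`: the potentially non-zero entries are computed from the diagonal downwards. -/
def choleskyColumn {M : ℕ} (Q : Matrix (Fin M) (Fin M) ℝ) (L : Matrix (Fin M) (Fin M) ℝ)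
    (m : Fin M) : Counted (Matrix (Fin M) (Fin M) ℝ) :=
  ((List.finRange M).filter fun j => decide (PotentialNonzero (condIndepGraph Q) j m)).foldlM
    (fun (A : Matrix (Fin M) (Fin M) ℝ) j => do
      let x ← choleskyEntry Q A j m
      pure (A.updateRow j (Function.update (A j) m x))) L

/-- The columnwise sparse Cholesky factorization. -/
def cholesky {M : ℕ} (Q : Matrix (Fin M) (Fin M) ℝ) : Counted (Matrix (Fin M) (Fin M) ℝ) :=
  (List.finRange M).foldlM (fun L m => choleskyColumn Q L m) 0

/-- The cost of sampling by sparse linear algebra: the number of flops of the sparse Cholesky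
factorization. -/
def costSLA {M : ℕ} (Q : Matrix (Fin M) (Fin M) ℝ) : ℕ := (cholesky Q).ops

/-! ### Rate of convergence and relaxation time of a Markov chain -/

/-- `P ^ t f`, where `P f x = ∫ f dP(x, ·)`. -/
def kernelIter {X : Type} [MeasurableSpace X] (P : Kernel X X) (f : X → ℝ) (t : ℕ) : X → ℝ :=
  (fun (g : X → ℝ) x => ∫ y, g y ∂(P x))^[t] f

/-- The `L²(π)`-rate of convergence of the chain with transition kernel `P`: the infimum of the `r`
such that `‖P ^ t f - π f‖ = O(r ^ t)` in `L²(π)` for every `f ∈ L²(π)`. -/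
def l2Rate {X : Type} [MeasurableSpace X] (P : Kernel X X) (π : Measure X) : ℝ≥0∞ :=
  sInf {ρ : ℝ≥0∞ | ∃ r : ℝ≥0, ρ = r ∧ ∀ f : X → ℝ, MemLp f 2 π → ∃ C : ℝ≥0, ∀ t : ℕ,
    eLpNorm (fun x => kernelIter P f t x - ∫ y, f y ∂π) 2 π ≤ (C : ℝ≥0∞) * (r : ℝ≥0∞) ^ t}

/-- The relaxation time `1 / (1 - rate)`; it is `∞` if the rate is (at least) `1`. -/
def relaxationTime {X : Type} [MeasurableSpace X] (P : Kernel X X) (π : Measure X) : ℝ≥0∞ :=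
  (1 - l2Rate P π)⁻¹

/-! ### Gaussian crossed effect models with two factors -/

/-- Data and parameters of the Gaussian crossed effect model with two factors (indexed by `Fin 2`),
`I` levels per factor and `N` real observations:
`y n ∼ N(a⁽⁰⁾ + a⁽¹⁾_{i₁[n]} + a⁽²⁾_{i₂[n]}, 1/τ)`, `a⁽ᵏ⁾_i ∼ N(0, 1/τₖ)`, `a⁽⁰⁾ ∼ N(μpr, 1/tpr)`,
where `tpr = 0` stands for the flat prior. -/
structure Model (I N : ℕ) where
  /-- `lev k n` is the level of factor `k` in observation `n`. -/
  lev : Fin 2 → Fin N → Fin I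
  y : Fin N → ℝ
  /-- Precision of the observations. -/
  τ : ℝ
  /-- Prior precisions of the two factors. -/
  τf : Fin 2 → ℝ
  /-- Prior mean and precision of the global mean. -/
  μpr : ℝ
  tpr : ℝ

/-- The regression parameters `(a⁽⁰⁾, (a⁽ᵏ⁾)ₖ)`. -/
abbrev State (I : ℕ) : Type := ℝ × (Fin 2 → Fin I → ℝ)

namespace Model

variable {I N : ℕ}

/-- Number of observations at level `i` of the first and level `j` of the second factor. -/
def cooc (D : Model I N) (i j : Fin I) : ℕ :=
  (Finset.univ.filter fun n => D.lev 0 n = i ∧ D.lev 1 n = j).card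

/-- Number of observations at level `i` of factor `k`. -/
def occ (D : Model I N) (k : Fin 2) (i : Fin I) : ℕ :=
  (Finset.univ.filter fun n => D.lev k n = i).card

/-- Every level of every factor has the same number `N / I` of observations. -/
def BalancedLevels (D : Model I N) : Prop :=
  ∀ (k : Fin 2) (i : Fin I), (D.occ k i : ℝ) = N / I

/-- The number `p = I + I` of factor levels. -/
def p (_ : Model I N) : ℝ := 2 * I

/-- The average number `2 N / p` of observations per factor level. -/
def nbar (D : Model I N) : ℝ := 2 * N / D.p

/-- Design matrix: the linear predictor of observation `n` is `∑ v, X n v * θ v`. The column `none`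
belongs to `a⁽⁰⁾`, the column `some (k, i)` to level `i` of factor `k`. -/
def designMatrix (D : Model I N) : Matrix (Fin N) (Option (Fin 2 × Fin I)) ℝ :=
  fun n v => match v with
    | none => 1
    | some (k, i) => if D.lev k n = i then 1 else 0

/-- Prior precisions of the regression parameters. -/
def priorPrec (D : Model I N) : Option (Fin 2 × Fin I) → ℝ
  | none => D.tpr
  | some (k, _) => D.τf k

/-- The ordering `(a⁽¹⁾_1, …, a⁽¹⁾_I, a⁽²⁾_1, …, a⁽²⁾_I, a⁽⁰⁾)`. -/
def ordering (I : ℕ) : Fin (2 * I + 1) ≃ Option (Fin 2 × Fin I) :=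
  finSuccEquivLast.trans (Equiv.optionCongr finProdFinEquiv.symm)

/-- The posterior precision matrix, prior precision plus `τ Xᵀ X`, in the above ordering. -/
def precision (D : Model I N) : Matrix (Fin (2 * I + 1)) (Fin (2 * I + 1)) ℝ :=
  (Matrix.diagonal D.priorPrec + D.τ • (D.designMatrix.transpose * D.designMatrix)).submatrix
    (ordering I) (ordering I)

/-- Unnormalized posterior density (prior times likelihood). -/
def postWeight (D : Model I N) (θ : State I) : ℝ :=
  Real.exp (-(D.tpr * (θ.1 - D.μpr) ^ 2 + ∑ k, ∑ i, D.τf k * θ.2 k i ^ 2) / 2) *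
    ∏ n, Real.exp (-D.τ * (D.y n - (θ.1 + θ.2 0 (D.lev 0 n) + θ.2 1 (D.lev 1 n))) ^ 2 / 2)

/-- The posterior law of the regression parameters given the data and the precisions: the
normalization of the measure with Lebesgue density `postWeight`. -/
def posterior (D : Model I N) : Measure (State I) :=
  ProbabilityTheory.cond (volume.withDensity fun θ => ENNReal.ofReal (D.postWeight θ)) Set.univ

instance (D : Model I N) : IsFiniteMeasure D.posterior := by
  unfold posterior; infer_instance

/-- The state in which `(a⁽⁰⁾, a⁽ᵏ⁾)` is `u` and the effects of the other factor are `b`. -/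
def assemble (k : Fin 2) (u : ℝ × (Fin I → ℝ)) (b : Fin I → ℝ) : State I :=
  (u.1, fun l => if l = k then u.2 else b)

/-- One block update of the collapsed Gibbs sampler: `(a⁽⁰⁾, a⁽ᵏ⁾)` is redrawn from its posterior
law given the effects of the other factor `k.rev`, which are kept. -/
def blockKernel (D : Model I N) (k : Fin 2) : Kernel (State I) (State I) :=
  (((condDistrib (fun θ : State I => (θ.1, θ.2 k)) (fun θ : State I => θ.2 k.rev) D.posterior) ×ₖ
      Kernel.id).comap (fun θ : State I => θ.2 k.rev) (by fun_prop)).map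
    fun x => assemble k x.1 x.2

/-- One iteration of the collapsed Gibbs sampler: the blocks of the first and of the second factor
are updated in turn. -/
def gibbsKernel (D : Model I N) : Kernel (State I) (State I) :=
  D.blockKernel 1 ∘ₖ D.blockKernel 0

/-- The noise that one block update consumes. -/
abbrev Noise (I : ℕ) : Type := ℝ × (Fin I → ℝ)

/-- The law of independent standard normal variables. -/
def noiseLaw (I : ℕ) : Measure (Noise I) :=
  (gaussianReal 0 1).prod (Measure.pi fun _ => gaussianReal 0 1)

/-- Number of observations and sum of the residuals `y n - a⁽ˡ⁾_{iₗ[n]}`, `l = k.rev`, for each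
level of factor `k`. -/
def levelSums (D : Model I N) (k : Fin 2) (θ : State I) :
    Counted ((Fin I → ℝ) × (Fin I → ℝ)) :=
  (List.finRange N).foldlM (fun (cs : (Fin I → ℝ) × (Fin I → ℝ)) n => do
    let i := D.lev k n
    let c ← op (cs.1 i + 1)
    let r ← op (D.y n - θ.2 k.rev (D.lev k.rev n))
    let s ← op (cs.2 i + r)
    pure (Function.update cs.1 i c, Function.update cs.2 i s)) (0, 0)

/-- Precision and precision times mean of `a⁽⁰⁾` given the effects of the factor `k.rev`, from the
counts `c` and the residual sums `s`. -/
def globalParams (D : Model I N) (k : Fin 2) (c s : Fin I → ℝ) : Counted (ℝ × ℝ) := do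
  let h₀ ← op (D.tpr * D.μpr)
  (List.finRange I).foldlM (fun (ph : ℝ × ℝ) i => do
    let u ← op (D.τ * c i)
    let v ← op (D.τf k + u)
    let q ← op (D.τ * D.τf k)
    let w ← op (q / v)
    let wc ← op (w * c i)
    let P ← op (ph.1 + wc)
    let ws ← op (w * s i)
    let H ← op (ph.2 + ws)
    pure (P, H)) (D.tpr, h₀)

/-- A draw from `N(h / v, 1 / v)`, where `z` is a standard normal draw. -/
def normalDraw (h v z : ℝ) : Counted ℝ := do
  let m ← op (h / v)
  let g ← op z
  let sd ← op (Real.sqrt v)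
  let e ← op (g / sd)
  op (m + e)

/-- Independent draws of the effects of factor `k` given `a⁽⁰⁾ = a₀` and the other factor. -/
def levelDraws (D : Model I N) (k : Fin 2) (c s : Fin I → ℝ) (a₀ : ℝ) (z : Fin I → ℝ) :
    Counted (Fin I → ℝ) :=
  (List.finRange I).foldlM (fun (a : Fin I → ℝ) i => do
    let u ← op (D.τ * c i)
    let v ← op (D.τf k + u)
    let ca ← op (c i * a₀)
    let r ← op (s i - ca)
    let h ← op (D.τ * r)
    let x ← normalDraw h v (z i)
    pure (Function.update a i x)) 0

/-- Implementation of the block update of factor `k`: first `a⁽⁰⁾` is drawn given the effects of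
the other factor, then the effects of factor `k` given `a⁽⁰⁾` and the effects of the other factor. -/
def blockProgram (D : Model I N) (k : Fin 2) (θ : State I) (z : Noise I) :
    Counted (State I) := do
  let cs ← D.levelSums k θ
  let ph ← D.globalParams k cs.1 cs.2
  let a₀ ← normalDraw ph.2 ph.1 z.1
  let a ← D.levelDraws k cs.1 cs.2 a₀ z.2
  pure (assemble k (a₀, a) (θ.2 k.rev))

/-- Implementation of one iteration of the collapsed Gibbs sampler. -/
def gibbsProgram (D : Model I N) (θ : State I) (z : Noise I × Noise I) : Counted (State I) := do
  let θ' ← D.blockProgram 0 θ z.1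
  D.blockProgram 1 θ' z.2

/-- The block programs draw exactly from the conditional laws that define the sampler. -/
def ProgramExact (D : Model I N) : Prop :=
  ∀ k : Fin 2, ∀ᵐ θ ∂D.posterior,
    (noiseLaw I).map (fun z => (D.blockProgram k θ z).val) = D.blockKernel k θ

/-- Largest number of operations in one iteration of the collapsed Gibbs sampler. -/
def costPerIteration (D : Model I N) : ℝ≥0∞ :=
  ⨆ (θ : State I) (z : Noise I × Noise I), ((D.gibbsProgram θ z).ops : ℝ≥0∞)

/-- The cost of the Gibbs sampler: cost per iteration times relaxation time. -/
def costGibbs (D : Model I N) : ℝ≥0∞ :=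
  D.costPerIteration * relaxationTime D.gibbsKernel D.posterior

end Model

/-! ### The worst-case balanced levels design -/

/-- The rule for the rows other than the last one. Rows and columns are numbered from `0`; with
numbers from `1` the conditions read `i = j`, or `i < j` and `d(i-1) ≤ j-2 < di` mod `I-1`, or
`j < i` and `d(i-1) ≤ j-1 < di` mod `I-1`. -/
def RegularCell (d I i j : ℕ) : Prop :=
  i = j ∨
  (i < j ∧ ∃ r, d * i ≤ r ∧ r < d * (i + 1) ∧ r + 1 ≡ j [MOD (I - 1)]) ∨
  (j < i ∧ ∃ r, d * i ≤ r ∧ r < d * (i + 1) ∧ r ≡ j [MOD (I - 1)])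

open Classical in
/-- The counts of the worst-case design; the last row fills up the columns that contain at most `d`
observations in the other rows. -/
def worstDesign (d I : ℕ) (i j : Fin I) : ℕ :=
  if (i : ℕ) + 1 < I then
    (if RegularCell d I i j then 1 else 0)
  else
    (if ∑ i' : Fin I, (if (i' : ℕ) + 1 < I ∧ RegularCell d I i' j then 1 else 0) ≤ d
      then 1 else 0)

end CrossedEffects

end

/-!
Every column of the design meets either `d - 1` or `d` of the off-diagonal windows of the first
`I - 1` rows, because the `d (I - 1)` window positions run `d` times through the residues modulo
`I - 1`; the last row supplies the missing observation. Since row `(j - 1) / d` links column `j` to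
an earlier column, the columns form a tree, and paths through earlier positions connect any two late
positions of the ordering: the trailing block of the Cholesky factor, of size proportional to `I`,
has no structural zeros.

Completing squares in the posterior density shows that a block is drawn as an affine image of normal
noise. With balanced levels of size `c`, two block draws with the same noise bring the effects
closer in the Euclidean norm by the factor `τ c / (τ_k + τ c)`, because the dependence through
`a⁽⁰⁾` acts along the constant vectors only and does not increase the norm. Iterates of smooth
functions therefore converge at a rate equal to the product of the two factors. On `L²` the sampler
is the product `p₀ p₁` of two orthogonal projections, and the operator `p₀ p₁ p₀ - e` is symmetric,
where `e` is the projection onto the constants: for a symmetric operator, log-convexity of the norms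
of the iterates turns decay on a dense set into an operator norm bound. So the relaxation time is at
most `1 + τ c / τ₁`, at a cost per iteration linear in the number of observations.
-/

namespace CrossedEffects

/-! ### Rows and columns of the design -/

/-- The window `[d i, d (i + 1))` that row `i` of the design is filled from contains an integer
congruent to `a` modulo `n`. Both off-diagonal rules of `RegularCell` are of this form. -/
def WindowHits (d n i a : ℕ) : Prop :=
  ∃ r, d * i ≤ r ∧ r < d * (i + 1) ∧ r ≡ a [MOD n]

lemma regularCell_iff {d n i j : ℕ} :
    RegularCell d (n + 1) i j ↔
      i = j ∨ (i < j ∧ WindowHits d n i (j - 1)) ∨ (j < i ∧ WindowHits d n i j) := by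
  refine or_congr_right (or_congr_left (and_congr_right fun hij => ?_))
  obtain ⟨k, rfl⟩ : ∃ k, j = k + 1 := ⟨j - 1, by omega⟩
  simp only [WindowHits, Nat.add_sub_cancel]
  exact exists_congr fun r => and_congr_right' <| and_congr_right' <|
    ⟨Nat.ModEq.add_right_cancel' 1, Nat.ModEq.add_right 1⟩

lemma regularCell_succAbove {d n : ℕ} (i : Fin (n + 1)) (j : Fin n) :
    RegularCell d (n + 1) i (i.succAbove j) ↔ WindowHits d n i j := by
  rw [regularCell_iff]
  rcases Fin.castSucc_lt_or_lt_succ i j with h | h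
  · have hj : (j : ℕ) < i := h
    simp [Fin.succAbove_of_castSucc_lt i j h, hj, hj.ne', hj.le]
  · have hj : (i : ℕ) < j + 1 := h
    simp [Fin.succAbove_of_lt_succ i j h, hj, hj.ne, hj.le.not_gt]

open Classical in
lemma card_windowHits_row {d n : ℕ} (hdn : d ≤ n) (i : ℕ) :
    ((Finset.range n).filter fun a => WindowHits d n i a).card = d := by
  have himage : (Finset.range n).filter (fun a => WindowHits d n i a) =
      (Finset.Ico (d * i) (d * i + d)).image (· % n) := by
    ext a
    simp only [Finset.mem_filter, Finset.mem_range, Finset.mem_image, Finset.mem_Ico]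
    constructor
    · rintro ⟨ha, r, hr, hr', h⟩
      exact ⟨r, ⟨hr, by rwa [← Nat.mul_succ]⟩, by rw [h, Nat.mod_eq_of_lt ha]⟩
    · rintro ⟨r, ⟨hr, hr'⟩, rfl⟩
      exact ⟨Nat.mod_lt _ (by omega), r, hr, by rwa [Nat.mul_succ], (Nat.mod_modEq r n).symm⟩
  rw [himage, Finset.card_image_of_injOn, Nat.card_Ico, Nat.add_sub_cancel_left]
  exact (Nat.mod_injOn_Ico (d * i) n).mono fun r hr => by
    simp only [Finset.coe_Ico, Set.mem_Ico] at hr ⊢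
    omega

lemma strictMono_add_mul_div {d n : ℕ} (a : ℕ) (hd : 0 < d) (hdn : d ≤ n) :
    StrictMono fun t => (a + n * t) / d := by
  refine strictMono_nat_of_lt_succ fun t => ?_
  calc (a + n * t) / d < (a + n * t + d) / d := by
        rw [Nat.add_div_right _ hd]
        exact Nat.lt_succ_self _
    _ ≤ (a + n * (t + 1)) / d := Nat.div_le_div_right (by rw [Nat.mul_succ]; omega)

open Classical in
/-- The windows tile `[0, d n)`, where the class of `a` is represented by the `a + n t`, `t < d`;
since `d ≤ n`, these lie in different windows. -/
lemma card_windowHits_column {d n a : ℕ} (hd : 0 < d) (hdn : d ≤ n) (ha : a < n) (P : ℕ → Prop)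
    [DecidablePred P] :
    ((Finset.range n).filter fun i => P i ∧ WindowHits d n i a).card =
      ((Finset.range d).filter fun t => P ((a + n * t) / d)).card := by
  refine (Finset.card_nbij (fun t => (a + n * t) / d) ?_
    (strictMono_add_mul_div a hd hdn).injective.injOn ?_).symm
  · intro t ht
    simp only [Finset.coe_filter, Finset.mem_range, Set.mem_ofPred_eq] at ht ⊢
    have hlt : a + n * t < d * n := by nlinarith [Nat.mul_le_mul_left n (Nat.succ_le_of_lt ht.1)]
    exact ⟨Nat.div_lt_of_lt_mul hlt, ht.2, a + n * t, Nat.mul_div_le _ _,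
      Nat.lt_mul_div_succ _ hd, by simp [Nat.ModEq]⟩
  · intro i hi
    simp only [Finset.coe_filter, Finset.mem_range, Set.mem_ofPred_eq] at hi
    obtain ⟨hi, hP, r, hr, hr', hra⟩ := hi
    have hr_eq : a + n * (r / n) = r := by
      rw [← Nat.mod_eq_of_lt ha, ← hra, Nat.mod_add_div]
    have hdiv : r / d = i :=
      Nat.div_eq_of_lt_le (by rwa [mul_comm]) (by rwa [mul_comm])
    have hlt : r < n * d := by nlinarith [Nat.mul_le_mul_left d (Nat.succ_le_of_lt hi)]
    refine ⟨r / n, ?_, by simp only [hr_eq, hdiv]⟩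
    simpa only [Finset.coe_filter, Finset.mem_range, Set.mem_ofPred_eq, hr_eq, hdiv]
      using ⟨Nat.div_lt_of_lt_mul hlt, hP⟩

open Classical in
/-- Only an index `t` with `d j < j + n t < d (j + 1)` is in neither set, and since `d ≤ n` there
is at most one. -/
lemma card_above_add_card_below_mem_Icc {d n : ℕ} (hd : 0 < d) (hdn : d ≤ n) (j : ℕ) :
    ((Finset.range d).filter fun t => j < (j + n * t) / d).card +
      ((Finset.range d).filter fun t => (j - 1 + n * t) / d < j).card ∈ Set.Icc (d - 1) d := by
  let above := fun t => j < (j + n * t) / d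
  let below := fun t => (j - 1 + n * t) / d < j
  have habove (t : ℕ) : above t ↔ d * j + d ≤ j + n * t := by
    rw [← Nat.mul_succ, mul_comm d, ← Nat.le_div_iff_mul_le hd, Nat.succ_le_iff]
  have hbelow (t : ℕ) : below t ↔ j - 1 + n * t < d * j := by
    rw [mul_comm d, ← Nat.div_lt_iff_lt_mul hd]
  have hdisj : Disjoint ((Finset.range d).filter above) ((Finset.range d).filter below) := by
    rw [Finset.disjoint_filter]
    intro t _
    rw [habove, hbelow]
    omega
  have hneither : ((Finset.range d).filter fun t => ¬(above t ∨ below t)).card ≤ 1 := by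
    have hlt_false : ∀ t t', t < t' → ¬(above t ∨ below t) → above t' ∨ below t' := by
      intro t t' htt' ht
      have := Nat.mul_le_mul_left n (Nat.succ_le_of_lt htt')
      rw [Nat.mul_succ] at this
      rw [habove, hbelow] at ht ⊢
      have := Nat.le_mul_of_pos_left j hd
      rcases Nat.eq_zero_or_pos j with rfl | hj <;> omega
    refine Finset.card_le_one.2 fun t ht t' ht' => ?_
    rw [Finset.mem_filter] at ht ht'
    rcases lt_trichotomy t t' with h | h | h
    · exact absurd (hlt_false t t' h ht.2) ht'.2
    · exact h
    · exact absurd (hlt_false t' t h ht'.2) ht.2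
  have htotal := Finset.card_filter_add_card_filter_not (s := Finset.range d)
    fun t => above t ∨ below t
  rw [Finset.filter_or, Finset.card_union_of_disjoint hdisj, Finset.card_range] at htotal
  change ((Finset.range d).filter above).card + ((Finset.range d).filter below).card ∈ _
  exact ⟨by omega, by omega⟩

open Classical in
lemma card_regularCell_column_eq_add (d n j : ℕ) :
    ((Finset.range n).filter fun i => RegularCell d (n + 1) i j).card =
      (if j < n then 1 else 0) +
        (((Finset.range n).filter fun i => i < j ∧ WindowHits d n i (j - 1)).card +
          ((Finset.range n).filter fun i => j < i ∧ WindowHits d n i j).card) := by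
  simp only [regularCell_iff]
  rw [Finset.filter_or, Finset.filter_or, Finset.card_union_of_disjoint,
    Finset.card_union_of_disjoint, Finset.filter_eq']
  · split_ifs <;> simp_all
  · exact Finset.disjoint_filter.2 fun i _ h => by omega
  · rw [← Finset.filter_or]
    exact Finset.disjoint_filter.2 fun i _ h => by omega

open Classical in
lemma card_regularCell_column_mem_Icc {d n j : ℕ} (hd : 0 < d) (hdn : d ≤ n) (hj : j ≤ n) :
    ((Finset.range n).filter fun i => RegularCell d (n + 1) i j).card ∈ Set.Icc d (d + 1) := by
  rw [card_regularCell_column_eq_add, card_windowHits_column hd hdn (by omega) (· < j)]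
  rcases hj.lt_or_eq with hj | rfl
  · have hcount := card_above_add_card_below_mem_Icc hd hdn j
    rw [card_windowHits_column hd hdn hj (j < ·), if_pos hj]
    rw [Set.mem_Icc] at hcount ⊢
    omega
  · have hbelow : (Finset.range d).filter (fun t => (j - 1 + j * t) / d < j) = Finset.range d := by
      refine Finset.filter_true_of_mem fun t ht => Nat.div_lt_of_lt_mul ?_
      nlinarith [Nat.mul_le_mul_left j (Nat.succ_le_of_lt (Finset.mem_range.1 ht)),
        Nat.sub_add_cancel (hd.trans_le hdn)]
    have habove : (Finset.range j).filter (fun i => j < i ∧ WindowHits d j i j) = ∅ :=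
      Finset.filter_eq_empty_iff.2 fun i hi h => (Finset.mem_range.1 hi).not_gt h.1
    simp [hbelow, habove]

open Classical in
lemma sum_ite_regularCell_eq_card (d n j : ℕ) :
    ∑ i : Fin (n + 1), (if (i : ℕ) + 1 < n + 1 ∧ RegularCell d (n + 1) i j then 1 else 0) =
      ((Finset.range n).filter fun i => RegularCell d (n + 1) i j).card := by
  rw [Fin.sum_univ_castSucc, Finset.card_filter, Finset.sum_range]
  simp

lemma sum_worstDesign_column {d I : ℕ} (hd : 0 < d) (hI : d + 1 ≤ I) (j : Fin I) :
    ∑ i, worstDesign d I i j = d + 1 := by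
  classical
  obtain ⟨n, rfl⟩ : ∃ n, I = n + 1 := ⟨I - 1, by omega⟩
  have hregular : ∑ i : Fin n, worstDesign d (n + 1) i.castSucc j =
      ((Finset.range n).filter fun i => RegularCell d (n + 1) i j).card := by
    rw [Finset.card_filter, Finset.sum_range]
    exact Finset.sum_congr rfl fun i _ => by simp [worstDesign]
  have hmem := card_regularCell_column_mem_Icc hd (by omega : d ≤ n) (by omega : (j : ℕ) ≤ n)
  rw [Set.mem_Icc] at hmem
  rw [Fin.sum_univ_castSucc, hregular, worstDesign, if_neg (by simp), sum_ite_regularCell_eq_card]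
  split_ifs <;> omega

lemma sum_worstDesign_row_of_lt {d I : ℕ} (hI : d + 1 ≤ I) {i : Fin I} (hi : (i : ℕ) + 1 < I) :
    ∑ j, worstDesign d I i j = d + 1 := by
  classical
  obtain ⟨n, rfl⟩ : ∃ n, I = n + 1 := ⟨I - 1, by omega⟩
  rw [Fin.sum_univ_succAbove _ i]
  simp only [worstDesign, if_pos hi, regularCell_succAbove]
  rw [if_pos (show RegularCell _ _ _ _ from Or.inl rfl),
    ← Finset.sum_range fun a => if WindowHits d n i a then 1 else 0,
    ← Finset.card_filter, card_windowHits_row (by omega), add_comm]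

lemma sum_worstDesign_row {d I : ℕ} (hd : 0 < d) (hI : d + 1 ≤ I) (i : Fin I) :
    ∑ j, worstDesign d I i j = d + 1 := by
  by_cases hi : (i : ℕ) + 1 < I
  · exact sum_worstDesign_row_of_lt hI hi
  obtain ⟨n, rfl⟩ : ∃ n, I = n + 1 := ⟨I - 1, by omega⟩
  obtain rfl : i = Fin.last n := Fin.ext (by simp; omega)
  have htotal : ∑ i, ∑ j, worstDesign d (n + 1) i j = (n + 1) * (d + 1) := by
    rw [Finset.sum_comm, Finset.sum_congr rfl fun j _ => sum_worstDesign_column hd hI j]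
    simp
  rw [Fin.sum_univ_castSucc, Finset.sum_congr rfl fun (i : Fin n) _ =>
    sum_worstDesign_row_of_lt hI (i := i.castSucc) (by simp)] at htotal
  simp only [Finset.sum_const, Finset.card_univ, Fintype.card_fin, smul_eq_mul, add_mul n,
    one_mul] at htotal
  omega

lemma worstDesign_le_one (d I : ℕ) (i j : Fin I) : worstDesign d I i j ≤ 1 := by
  unfold worstDesign
  split_ifs <;> simp

lemma worstDesign_diag (d : ℕ) {I : ℕ} {i : Fin I} (hi : (i : ℕ) + 1 < I) :
    worstDesign d I i i = 1 := by
  rw [worstDesign, if_pos hi, if_pos (show RegularCell d I i i from Or.inl rfl)]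

lemma worstDesign_of_val_eq {d I : ℕ} {i j : Fin I} (hd : 0 < d) (hj : 0 < (j : ℕ))
    (hi : (i : ℕ) = (j - 1) / d) : worstDesign d I i j = 1 := by
  have hij : (i : ℕ) < j := by
    have := Nat.div_le_self (j - 1) d
    omega
  rw [worstDesign, if_pos (by omega), if_pos]
  refine Or.inr (Or.inl ⟨hij, j - 1, ?_, ?_, by rw [Nat.sub_add_cancel hj]⟩)
  · rw [hi]; exact Nat.mul_div_le _ _
  · rw [hi]; exact Nat.lt_mul_div_succ _ hd

namespace Model

variable {I N : ℕ}

lemma occ_zero_eq_sum_cooc (D : Model I N) (i : Fin I) : D.occ 0 i = ∑ j, D.cooc i j := by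
  simp only [occ, cooc]
  rw [Finset.card_eq_sum_card_fiberwise (f := D.lev 1) (t := Finset.univ) (by simp)]
  simp only [Finset.filter_filter]

lemma occ_one_eq_sum_cooc (D : Model I N) (j : Fin I) : D.occ 1 j = ∑ i, D.cooc i j := by
  simp only [occ, cooc]
  rw [Finset.card_eq_sum_card_fiberwise (f := D.lev 0) (t := Finset.univ) (by simp)]
  simp only [Finset.filter_filter, and_comm]

lemma sum_occ (D : Model I N) (k : Fin 2) : ∑ i, D.occ k i = N := by
  simpa [occ] using (Finset.card_eq_sum_card_fiberwise (s := (Finset.univ : Finset (Fin N)))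
    (f := D.lev k) (t := Finset.univ) (by simp)).symm

lemma occ_eq_of_worstDesign (D : Model I N) {d : ℕ} (hd : 0 < d) (hI : d + 1 ≤ I)
    (hdesign : ∀ i j, D.cooc i j = worstDesign d I i j) (k : Fin 2) (i : Fin I) :
    D.occ k i = d + 1 := by
  fin_cases k
  · simp only [Fin.zero_eta, occ_zero_eq_sum_cooc, hdesign, sum_worstDesign_row hd hI]
  · simp only [Fin.mk_one, occ_one_eq_sum_cooc, hdesign, sum_worstDesign_column hd hI]

lemma numObs_eq_mul_of_occ_eq (D : Model I N) {c : ℕ} (hocc : ∀ k i, D.occ k i = c) :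
    N = I * c := by
  rw [← D.sum_occ 0]
  simp [hocc]

lemma nbar_eq_of_occ_eq (D : Model I N) {c : ℕ} (hI : 0 < I) (hocc : ∀ k i, D.occ k i = c) :
    D.nbar = c := by
  have hI' : (I : ℝ) ≠ 0 := by positivity
  rw [nbar, p, D.numObs_eq_mul_of_occ_eq hocc]
  push_cast
  field_simp

lemma balancedLevels_of_occ_eq (D : Model I N) {c : ℕ} (hocc : ∀ k i, D.occ k i = c) :
    D.BalancedLevels := by
  intro k i
  have hI : (I : ℝ) ≠ 0 := Nat.cast_ne_zero.2 (Fin.pos i).ne'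
  rw [hocc, D.numObs_eq_mul_of_occ_eq hocc]
  push_cast
  field_simp

/-! ### Sparsity of the posterior precision matrix -/

/-- The position of level `i` of factor `k` in `ordering I`; the global mean is in position
`Fin.last (2 * I)`. -/
def pos (k : Fin 2) (i : Fin I) : Fin (2 * I + 1) := (ordering I).symm (some (k, i))

@[simp] lemma ordering_pos (k : Fin 2) (i : Fin I) : ordering I (pos k i) = some (k, i) := by
  simp [pos]

@[simp] lemma ordering_last : ordering I (Fin.last (2 * I)) = none := by
  simp [ordering]

lemma val_pos (k : Fin 2) (i : Fin I) : (pos k i : ℕ) = i + I * k := by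
  have hpos : pos k i = (finProdFinEquiv (k, i)).castSucc := by
    rw [pos, Equiv.symm_apply_eq]
    simp [ordering, Equiv.eq_symm_apply]
  simp [hpos, finProdFinEquiv]

@[simp] lemma pos_inj {k l : Fin 2} {i j : Fin I} : pos k i = pos l j ↔ k = l ∧ i = j := by
  simp [pos]

lemma pos_ne_last (k : Fin 2) (i : Fin I) : pos k i ≠ Fin.last (2 * I) := fun h => by
  simpa using congrArg (ordering I) h

lemma pos_one_le_pos_one {i j : Fin I} : pos 1 i ≤ pos 1 j ↔ i ≤ j := by
  rw [Fin.le_def, Fin.le_def, val_pos, val_pos, Nat.add_le_add_iff_right]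

lemma pos_zero_le_pos_one (i j : Fin I) : pos 0 i ≤ pos 1 j := by
  rw [Fin.le_def, val_pos, val_pos]
  simp only [Fin.val_zero, Fin.val_one]
  omega

lemma exists_eq_pos_one {a : Fin (2 * I + 1)} (ha : I ≤ (a : ℕ)) (hlast : a ≠ Fin.last _) :
    ∃ i, a = pos 1 i := by
  have hlt : (a : ℕ) < 2 * I := Fin.val_lt_last hlast
  exact ⟨⟨a - I, by omega⟩, Fin.ext (by simp only [val_pos, Fin.val_one]; omega)⟩

/-- The positions of the parameters in the linear predictor of observation `n`. The precision
matrix couples two parameters exactly if some observation involves both. -/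
def predictorSupport (D : Model I N) (n : Fin N) : Finset (Fin (2 * I + 1)) :=
  {Fin.last _, pos 0 (D.lev 0 n), pos 1 (D.lev 1 n)}

lemma designMatrix_nonneg (D : Model I N) (n : Fin N) (v : Option (Fin 2 × Fin I)) :
    0 ≤ D.designMatrix n v := by
  rcases v with _ | ⟨k, i⟩ <;> simp only [designMatrix]
  · exact zero_le_one
  · split_ifs <;> norm_num

lemma designMatrix_ne_zero_iff (D : Model I N) (n : Fin N) (a : Fin (2 * I + 1)) :
    D.designMatrix n (ordering I a) ≠ 0 ↔ a ∈ D.predictorSupport n := by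
  obtain ⟨v, rfl⟩ := (ordering I).symm.surjective a
  rcases v with _ | ⟨k, i⟩
  · have hlast : (ordering I).symm none = Fin.last _ := by rw [Equiv.symm_apply_eq, ordering_last]
    simp [designMatrix, predictorSupport, hlast]
  · change D.designMatrix n (ordering I (pos k i)) ≠ 0 ↔ pos k i ∈ D.predictorSupport n
    fin_cases k <;> simp [designMatrix, predictorSupport, pos_ne_last, eq_comm (a := i)]

lemma precision_ne_zero_iff (D : Model I N) (hτ : 0 < D.τ) {a b : Fin (2 * I + 1)}
    (hab : a ≠ b) :
    D.precision a b ≠ 0 ↔ ∃ n, a ∈ D.predictorSupport n ∧ b ∈ D.predictorSupport n := by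
  have hne : ordering I a ≠ ordering I b := (ordering I).injective.ne hab
  simp only [precision, Matrix.submatrix_apply, Matrix.add_apply, Matrix.diagonal_apply_ne _ hne,
    zero_add, Matrix.smul_apply, Matrix.mul_apply, Matrix.transpose_apply, smul_eq_mul]
  rw [mul_ne_zero_iff, and_iff_right hτ.ne', Ne, Finset.sum_eq_zero_iff_of_nonneg
    (fun n _ => mul_nonneg (D.designMatrix_nonneg _ _) (D.designMatrix_nonneg _ _))]
  simp only [← designMatrix_ne_zero_iff, Finset.mem_univ, true_imp_iff, not_forall, ← ne_eq,
    mul_ne_zero_iff]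

lemma condIndepGraph_precision_adj (D : Model I N) (hτ : 0 < D.τ) {a b : Fin (2 * I + 1)} :
    (condIndepGraph D.precision).Adj a b ↔
      a ≠ b ∧ ∃ n, a ∈ D.predictorSupport n ∧ b ∈ D.predictorSupport n := by
  rw [condIndepGraph, SimpleGraph.fromRel_adj]
  refine and_congr_right fun hab => ?_
  rw [D.precision_ne_zero_iff hτ hab, D.precision_ne_zero_iff hτ hab.symm]
  simp only [and_comm, or_self]

lemma adj_pos_zero_pos_one (D : Model I N) (hτ : 0 < D.τ) {i j : Fin I} (h : 0 < D.cooc i j) :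
    (condIndepGraph D.precision).Adj (pos 0 i) (pos 1 j) := by
  obtain ⟨n, hn⟩ := Finset.card_pos.1 h
  obtain ⟨hi, hj⟩ := (Finset.mem_filter.1 hn).2
  exact (D.condIndepGraph_precision_adj hτ).2
    ⟨by simp, n, by simp [predictorSupport, hi], by simp [predictorSupport, hj]⟩

lemma adj_last_pos_one (D : Model I N) (hτ : 0 < D.τ) {j : Fin I} (h : 0 < D.occ 1 j) :
    (condIndepGraph D.precision).Adj (Fin.last _) (pos 1 j) := by
  obtain ⟨n, hn⟩ := Finset.card_pos.1 h
  exact (D.condIndepGraph_precision_adj hτ).2 ⟨(pos_ne_last 1 j).symm, n,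
    by simp [predictorSupport], by simp [predictorSupport, (Finset.mem_filter.1 hn).2]⟩

lemma numObs_le_nQ (D : Model I N) (hτ : 0 < D.τ) (hcooc : ∀ i j, D.cooc i j ≤ 1) :
    N ≤ nQ D.precision := by
  classical
  calc N = (Finset.univ : Finset (Fin N)).card := (Finset.card_fin N).symm
    _ ≤ nQ D.precision := ?_
  refine Finset.card_le_card_of_injOn (fun n => (pos 1 (D.lev 1 n), pos 0 (D.lev 0 n))) ?_ ?_
  · intro n _
    rw [Finset.mem_coe, Finset.mem_filter]
    exact ⟨Finset.mem_univ _, pos_zero_le_pos_one _ _, (D.precision_ne_zero_iff hτ (by simp)).2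
      ⟨n, by simp [predictorSupport], by simp [predictorSupport]⟩⟩
  · intro n _ n' _ hnn'
    have hcell := hcooc (D.lev 0 n) (D.lev 1 n)
    rw [cooc, Finset.card_le_one] at hcell
    simp only [Prod.mk.injEq, pos_inj, true_and] at hnn'
    exact hcell n (by simp) n' (by simp [hnn'])

lemma nQ_le (D : Model I N) (hτ : 0 < D.τ) : nQ D.precision ≤ 2 * I + 1 + 9 * N := by
  classical
  let diagonal := (Finset.univ : Finset (Fin (2 * I + 1))).image fun a => (a, a)
  let coupled := (Finset.univ : Finset (Fin N)).biUnion fun n =>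
    D.predictorSupport n ×ˢ D.predictorSupport n
  have hsub : (Finset.univ.filter fun x : Fin (2 * I + 1) × Fin (2 * I + 1) =>
      x.2 ≤ x.1 ∧ D.precision x.1 x.2 ≠ 0) ⊆ diagonal ∪ coupled := by
    rintro ⟨a, b⟩ hx
    by_cases hab : a = b
    · exact Finset.mem_union_left _ (by simp [diagonal, hab])
    · obtain ⟨n, ha, hb⟩ := (D.precision_ne_zero_iff hτ hab).1 (Finset.mem_filter.1 hx).2.2
      exact Finset.mem_union_right _
        (Finset.mem_biUnion.2 ⟨n, Finset.mem_univ n, Finset.mk_mem_product ha hb⟩)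
  have hdiagonal : diagonal.card ≤ 2 * I + 1 := Finset.card_image_le.trans_eq (Finset.card_fin _)
  have hcoupled : coupled.card ≤ 9 * N := by
    refine Finset.card_biUnion_le.trans ((Finset.sum_le_card_nsmul _ _ 9 fun n _ => ?_).trans_eq ?_)
    · rw [Finset.card_product]
      exact Nat.mul_le_mul Finset.card_le_three Finset.card_le_three
    · simp [mul_comm]
  calc nQ D.precision ≤ (diagonal ∪ coupled).card := Finset.card_le_card hsub
    _ ≤ diagonal.card + coupled.card := Finset.card_union_le _ _
    _ ≤ 2 * I + 1 + 9 * N := add_le_add hdiagonal hcoupled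

end Model

/-! ### Fill-in of the Cholesky factor -/

lemma potentialNonzero_of_walk {M : ℕ} {G : SimpleGraph (Fin M)} {m u j : Fin M} (hmj : m ≤ j)
    (w : G.Walk m u) (hw : ∀ v ∈ w.support, v ≤ m) (huj : G.Adj u j) : PotentialNonzero G j m := by
  refine ⟨hmj, fun hsep => ?_⟩
  obtain ⟨v, hv, hmv, hvj⟩ := hsep (w.concat huj)
  rw [SimpleGraph.Walk.support_concat, List.mem_append, List.mem_singleton] at hv
  exact hv.elim (fun hv => hmv.not_ge (hw v hv)) hvj

lemma potentialNonzero_of_reachable {M : ℕ} {G : SimpleGraph (Fin M)} {m u j : Fin M}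
    (hmj : m ≤ j) (hu : u ≤ m)
    (hreach : (G.induce (Set.Iic m)).Reachable ⟨m, Set.mem_Iic.2 le_rfl⟩ ⟨u, Set.mem_Iic.2 hu⟩)
    (huj : G.Adj u j) : PotentialNonzero G j m := by
  obtain ⟨w⟩ := hreach
  let toAmbient : G.induce (Set.Iic m) →g G := (SimpleGraph.Embedding.induce (Set.Iic m)).toHom
  refine potentialNonzero_of_walk hmj (w.map toAmbient) (fun v hv => ?_) huj
  obtain ⟨x, -, rfl⟩ := List.mem_map.1 (SimpleGraph.Walk.support_map toAmbient w ▸ hv)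
  exact x.2

lemma potentialNonzero_self {M : ℕ} (G : SimpleGraph (Fin M)) (m : Fin M) :
    PotentialNonzero G m m := by
  refine ⟨le_rfl, fun hsep => ?_⟩
  obtain ⟨v, hv, -, hvm⟩ := hsep .nil
  exact hvm (by simpa using hv)

namespace Model

variable {I N : ℕ}

lemma adj_of_val_eq_div (D : Model I N) {d : ℕ} (hτ : 0 < D.τ) (hd : 0 < d)
    (hdesign : ∀ i j, D.cooc i j = worstDesign d I i j) {i j : Fin I} (hj : 0 < (j : ℕ))
    (hi : (i : ℕ) = (j - 1) / d) :
    (condIndepGraph D.precision).Adj (pos 0 i) (pos 1 j) ∧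
      (condIndepGraph D.precision).Adj (pos 0 i) (pos 1 i) := by
  have hij : (i : ℕ) < j := hi ▸ (Nat.div_le_self _ _).trans_lt (by omega)
  constructor <;> refine D.adj_pos_zero_pos_one hτ ?_ <;> rw [hdesign]
  · rw [worstDesign_of_val_eq hd hj hi]
    exact one_pos
  · rw [worstDesign_diag d (by omega)]
    exact one_pos

/-- Row `(j - 1) / d` of the design links column `j` to column `(j - 1) / d`, so the columns form a
`d`-ary tree with root `0`, and the path from a column to the root stays among earlier positions. -/
lemma reachable_root (D : Model I N) {d : ℕ} (hτ : 0 < D.τ) (hd : 0 < d)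
    (hdesign : ∀ i j, D.cooc i j = worstDesign d I i j) {m : Fin (2 * I + 1)} {root : Fin I}
    (hroot : (root : ℕ) = 0) (hrootm : pos 1 root ≤ m) (j : Fin I) (hjm : pos 1 j ≤ m) :
    ((condIndepGraph D.precision).induce (Set.Iic m)).Reachable
      ⟨pos 1 j, hjm⟩ ⟨pos 1 root, hrootm⟩ := by
  induction j using WellFoundedLT.induction with
  | ind j ih =>
    rcases Nat.eq_zero_or_pos (j : ℕ) with hj | hj
    · obtain rfl : j = root := Fin.ext (hj.trans hroot.symm)
      rfl
    · have hlt : ((j : ℕ) - 1) / d < j := (Nat.div_le_self _ _).trans_lt (by omega)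
      let i : Fin I := ⟨((j : ℕ) - 1) / d, hlt.trans j.2⟩
      have hij : i < j := hlt
      have him : pos 1 i ≤ m := (pos_one_le_pos_one.2 hij.le).trans hjm
      have hrow : pos 0 i ≤ m := (pos_zero_le_pos_one i j).trans hjm
      obtain ⟨hchild, hparent⟩ := D.adj_of_val_eq_div hτ hd hdesign (i := i) hj rfl
      have hstep₁ : ((condIndepGraph D.precision).induce (Set.Iic m)).Adj
          ⟨pos 1 j, hjm⟩ ⟨pos 0 i, hrow⟩ := hchild.symm
      have hstep₂ : ((condIndepGraph D.precision).induce (Set.Iic m)).Adj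
          ⟨pos 0 i, hrow⟩ ⟨pos 1 i, him⟩ := hparent
      exact hstep₁.reachable.trans (hstep₂.reachable.trans (ih i hij him))

lemma potentialNonzero_of_half_le (D : Model I N) {d : ℕ} (hτ : 0 < D.τ) (hd : 2 ≤ d)
    (hdesign : ∀ i j, D.cooc i j = worstDesign d I i j) (hocc : ∀ j, 0 < D.occ 1 j)
    {a b : Fin (2 * I + 1)} (ha : I + I / 2 ≤ (a : ℕ)) (hab : a ≤ b) :
    PotentialNonzero (condIndepGraph D.precision) b a := by
  rcases hab.eq_or_lt with rfl | hlt
  · exact potentialNonzero_self _ _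
  obtain ⟨m, rfl⟩ := exists_eq_pos_one (by omega) (hlt.trans_le (Fin.le_last b)).ne
  rcases eq_or_ne b (Fin.last _) with rfl | hb
  · exact potentialNonzero_of_reachable hab le_rfl .rfl (D.adj_last_pos_one hτ (hocc m)).symm
  obtain ⟨j, rfl⟩ := exists_eq_pos_one (by rw [Fin.le_def] at hab; omega) hb
  simp only [Fin.lt_def, val_pos, Fin.val_one] at hlt ha
  have hhalf : ((j : ℕ) - 1) / d ≤ (j - 1) / 2 := Nat.div_le_div_left hd two_pos
  let i : Fin I := ⟨((j : ℕ) - 1) / d, by omega⟩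
  have him : i ≤ m := show ((j : ℕ) - 1) / d ≤ m by omega
  obtain ⟨hchild, hparent⟩ :=
    D.adj_of_val_eq_div hτ (by omega) hdesign (i := i) (j := j) (by omega) rfl
  let root : Fin I := ⟨0, by omega⟩
  have hroot (l : Fin I) (hl : pos 1 l ≤ pos 1 m) :=
    D.reachable_root hτ (by omega) hdesign (root := root) rfl
      (pos_one_le_pos_one.2 (Nat.zero_le _ : root ≤ m)) l hl
  have hstep : ((condIndepGraph D.precision).induce (Set.Iic (pos 1 m))).Adj
      ⟨pos 1 i, pos_one_le_pos_one.2 him⟩ ⟨pos 0 i, pos_zero_le_pos_one i m⟩ := hparent.symm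
  exact potentialNonzero_of_reachable hab (pos_zero_le_pos_one i m)
    ((hroot m le_rfl).trans ((hroot i _).symm.trans hstep.reachable)) hchild

end Model

/-! ### Counted computations -/

namespace Counted

variable {α β : Type}

@[simp] lemma val_pure (a : α) : (pure a : Counted α).val = a := rfl

@[simp] lemma ops_pure (a : α) : (pure a : Counted α).ops = 0 := rfl

@[simp] lemma val_bind (x : Counted α) (f : α → Counted β) : (x >>= f).val = (f x.val).val := rfl

@[simp] lemma ops_bind (x : Counted α) (f : α → Counted β) :
    (x >>= f).ops = x.ops + (f x.val).ops := rfl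

@[simp] lemma val_op (a : α) : (op a).val = a := rfl

@[simp] lemma ops_op (a : α) : (op a).ops = 1 := rfl

lemma val_foldlM (f : α → β → Counted α) (l : List β) (a : α) :
    (l.foldlM f a).val = l.foldl (fun a b => (f a b).val) a := by
  induction l generalizing a with
  | nil => rfl
  | cons b l ih => simp [List.foldlM_cons, ih]

lemma ops_foldlM (f : α → β → Counted α) (cost : β → ℕ) (hcost : ∀ a b, (f a b).ops = cost b)
    (l : List β) (a : α) : (l.foldlM f a).ops = (l.map cost).sum := by
  induction l generalizing a with
  | nil => rfl
  | cons b l ih => simp [List.foldlM_cons, ih, hcost]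

lemma ops_foldlM_const (f : α → β → Counted α) {c : ℕ} (hc : ∀ a b, (f a b).ops = c)
    (l : List β) (a : α) : (l.foldlM f a).ops = c * l.length := by
  rw [ops_foldlM f (fun _ => c) hc, List.map_const', List.sum_replicate, smul_eq_mul, mul_comm]

end Counted

/-! ### Flops of the sparse Cholesky factorization -/

section Flops

variable {M : ℕ}

open Classical in
/-- The earlier columns `l` whose product `L m l * L j l` enters the computation of `L j m`. -/
noncomputable def updateColumns (Q : Matrix (Fin M) (Fin M) ℝ) (j m : Fin M) : Finset (Fin M) :=
  Finset.univ.filter fun l => l < m ∧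
    PotentialNonzero (condIndepGraph Q) m l ∧ PotentialNonzero (condIndepGraph Q) j l

lemma ops_choleskyEntry (Q L : Matrix (Fin M) (Fin M) ℝ) (j m : Fin M) :
    (choleskyEntry Q L j m).ops = 2 * (updateColumns Q j m).card + 1 := by
  have hlast (s : ℝ) : (if j = m then op (Real.sqrt s) else op (s / L m m)).ops = 1 := by
    split_ifs <;> rfl
  simp only [choleskyEntry, Counted.ops_bind, hlast]
  rw [Counted.ops_foldlM_const (c := 2) _ (by intros; rfl)]
  rfl

open Classical in
lemma ops_choleskyColumn (Q L : Matrix (Fin M) (Fin M) ℝ) (m : Fin M) :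
    (choleskyColumn Q L m).ops = ∑ j with PotentialNonzero (condIndepGraph Q) j m,
      (2 * (updateColumns Q j m).card + 1) := by
  rw [choleskyColumn, Counted.ops_foldlM _ (fun j => 2 * (updateColumns Q j m).card + 1)
    (fun A j => by simp [ops_choleskyEntry]), Finset.sum]
  simp [Finset.filter, Fin.univ_def]

open Classical in
lemma costSLA_eq_sum (Q : Matrix (Fin M) (Fin M) ℝ) :
    costSLA Q = ∑ m, ∑ j with PotentialNonzero (condIndepGraph Q) j m,
      (2 * (updateColumns Q j m).card + 1) := by
  rw [costSLA, cholesky, Counted.ops_foldlM _ _ (fun L m => ops_choleskyColumn Q L m),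
    Fin.sum_univ_def]

lemma nL_le (Q : Matrix (Fin M) (Fin M) ℝ) : nL Q ≤ M * M :=
  (Finset.sum_le_card_nsmul _ _ M fun _ _ => card_finset_fin_le _).trans (by simp)

lemma costSLA_le (Q : Matrix (Fin M) (Fin M) ℝ) : costSLA Q ≤ M * (M * (2 * M + 1)) := by
  classical
  rw [costSLA_eq_sum]
  refine (Finset.sum_le_card_nsmul _ _ (M * (2 * M + 1)) fun m _ => ?_).trans (by simp)
  refine (Finset.sum_le_card_nsmul _ _ (2 * M + 1) fun j _ => ?_).trans
    (Nat.mul_le_mul_right _ (card_finset_fin_le _))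
  gcongr
  exact card_finset_fin_le _

/-- The Cholesky factor of `Q` has no structural zeros below the diagonal from row and column `s₀`
on. -/
def DenseFrom (Q : Matrix (Fin M) (Fin M) ℝ) (s₀ : ℕ) : Prop :=
  ∀ l t : Fin M, s₀ ≤ (l : ℕ) → l ≤ t → PotentialNonzero (condIndepGraph Q) t l

end Flops

section DenseBlock

variable {s₀ s : ℕ} {Q : Matrix (Fin (s₀ + s)) (Fin (s₀ + s)) ℝ}

lemma sum_range_le_sum_fin_add (f : Fin (s₀ + s) → ℕ) (g : ℕ → ℕ)
    (h : ∀ m : Fin (s₀ + s), s₀ ≤ (m : ℕ) → g (m - s₀) ≤ f m) :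
    ∑ x ∈ Finset.range s, g x ≤ ∑ m, f m := by
  rw [Fin.sum_univ_add, Finset.sum_range]
  refine le_add_left (Finset.sum_le_sum fun x _ => ?_)
  simpa using h (Fin.natAdd s₀ x) (by simp)

open Classical in
lemma DenseFrom.le_card_column (hQ : DenseFrom Q s₀) {m : Fin (s₀ + s)} (hm : s₀ ≤ (m : ℕ)) :
    s - (m - s₀) ≤ (Finset.univ.filter (PotentialNonzero (condIndepGraph Q) · m)).card := by
  have hIci : Finset.Ici m ⊆ Finset.univ.filter (PotentialNonzero (condIndepGraph Q) · m) :=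
    fun j hj => Finset.mem_filter.2 ⟨Finset.mem_univ j, hQ m j hm (Finset.mem_Ici.1 hj)⟩
  have hcard := Finset.card_le_card hIci
  rw [Fin.card_Ici] at hcard
  omega

lemma DenseFrom.le_card_updateColumns (hQ : DenseFrom Q s₀) {j m : Fin (s₀ + s)}
    (hmj : m ≤ j) : (m : ℕ) - s₀ ≤ (updateColumns Q j m).card := by
  classical
  rcases lt_or_ge (m : ℕ) s₀ with hm | hm
  · omega
  rw [← show (Finset.Ico (⟨s₀, by omega⟩ : Fin (s₀ + s)) m).card = m - s₀ from Fin.card_Ico _ _]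
  refine Finset.card_le_card fun l hl => ?_
  obtain ⟨hsl, hlm⟩ := Finset.mem_Ico.1 hl
  exact Finset.mem_filter.2
    ⟨Finset.mem_univ l, hlm, hQ l m hsl hlm.le, hQ l j hsl (hlm.le.trans hmj)⟩

lemma sum_range_sub_mul_succ (s : ℕ) (g : ℕ → ℕ) :
    ∑ x ∈ Finset.range (s + 1), (s + 1 - x) * g x =
      ∑ x ∈ Finset.range s, (s - x) * g x + ∑ x ∈ Finset.range (s + 1), g x := by
  have hsplit (x) (hx : x ∈ Finset.range (s + 1)) : (s + 1 - x) * g x = (s - x) * g x + g x := by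
    rw [Nat.succ_sub (Finset.mem_range_succ_iff.1 hx), Nat.succ_mul]
  rw [Finset.sum_congr rfl hsplit, Finset.sum_add_distrib,
    Finset.sum_range_succ (fun x => (s - x) * g x), Nat.sub_self, zero_mul, add_zero]

lemma sq_le_two_mul_sum_range_sub (s : ℕ) : s ^ 2 ≤ 2 * ∑ x ∈ Finset.range s, (s - x) := by
  induction s with
  | zero => simp
  | succ s ih =>
    have hstep := sum_range_sub_mul_succ s fun _ => 1
    simp only [mul_one, Finset.sum_const, Finset.card_range, smul_eq_mul] at hstep
    rw [hstep]
    linarith [add_sq s 1]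

lemma sum_range_two_mul_add_one (r : ℕ) : ∑ x ∈ Finset.range r, (2 * x + 1) = r ^ 2 := by
  induction r with
  | zero => rfl
  | succ r ih => rw [Finset.sum_range_succ, ih]; ring

lemma cube_le_three_mul_sum_range (s : ℕ) :
    s ^ 3 ≤ 3 * ∑ x ∈ Finset.range s, (s - x) * (2 * x + 1) := by
  induction s with
  | zero => simp
  | succ s ih =>
    rw [sum_range_sub_mul_succ, sum_range_two_mul_add_one]
    linarith [show (s + 1) ^ 3 = s ^ 3 + 3 * s ^ 2 + 3 * s + 1 by ring, add_sq s 1]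

lemma DenseFrom.sq_le_nL {M : ℕ} {Q : Matrix (Fin M) (Fin M) ℝ} (hQ : DenseFrom Q s₀)
    (hM : M = s₀ + s) : s ^ 2 ≤ 2 * nL Q := by
  subst hM
  exact (sq_le_two_mul_sum_range_sub s).trans <| Nat.mul_le_mul_left 2 <|
    sum_range_le_sum_fin_add _ (fun x => s - x) fun _ hm => hQ.le_card_column hm

lemma DenseFrom.cube_le_costSLA {M : ℕ} {Q : Matrix (Fin M) (Fin M) ℝ} (hQ : DenseFrom Q s₀)
    (hM : M = s₀ + s) : s ^ 3 ≤ 3 * costSLA Q := by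
  classical
  subst hM
  refine (cube_le_three_mul_sum_range s).trans (Nat.mul_le_mul_left 3 ?_)
  rw [costSLA_eq_sum]
  refine sum_range_le_sum_fin_add _ (fun x => (s - x) * (2 * x + 1)) fun m hm => ?_
  refine (Nat.mul_le_mul_right _ (hQ.le_card_column hm)).trans ?_
  refine Finset.card_nsmul_le_sum _ _ (2 * (m - s₀) + 1) fun j hj => ?_
  gcongr
  exact hQ.le_card_updateColumns (Finset.mem_filter.1 hj).2.1

end DenseBlock

/-! ### Sparse Cholesky costs of the worst-case design -/

namespace Model

variable {I N d : ℕ}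

lemma denseFrom_precision (D : Model I N) (hτ : 0 < D.τ) (hd : 2 ≤ d) (hI : d + 1 ≤ I)
    (hdesign : ∀ i j, D.cooc i j = worstDesign d I i j) :
    DenseFrom D.precision (I + I / 2) := fun _ _ hl hlt =>
  D.potentialNonzero_of_half_le hτ hd hdesign
    (fun j => by rw [D.occ_eq_of_worstDesign (by omega) hI hdesign]; omega) hl hlt

lemma nQ_precision_bounds (D : Model I N) (hτ : 0 < D.τ) (hd : 2 ≤ d) (hI : d + 1 ≤ I)
    (hdesign : ∀ i j, D.cooc i j = worstDesign d I i j) :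
    1 / 2 * (D.p * D.nbar) ≤ nQ D.precision ∧ nQ D.precision ≤ 5 * (D.p * D.nbar) := by
  have hocc := D.occ_eq_of_worstDesign (by omega) hI hdesign
  have hN : N = I * (d + 1) := D.numObs_eq_mul_of_occ_eq hocc
  have hpn : D.p * D.nbar = 2 * N := by
    rw [D.nbar_eq_of_occ_eq (by omega) hocc, p, hN]
    push_cast
    ring
  have hlower : N ≤ nQ D.precision :=
    D.numObs_le_nQ hτ fun i j => (hdesign i j).trans_le (worstDesign_le_one d I i j)
  have hupper : nQ D.precision ≤ 10 * N := (D.nQ_le hτ).trans (by nlinarith)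
  rify at hlower hupper
  constructor <;> linarith

lemma nL_precision_bounds (D : Model I N) (hτ : 0 < D.τ) (hd : 2 ≤ d) (hI : d + 1 ≤ I)
    (hdesign : ∀ i j, D.cooc i j = worstDesign d I i j) :
    1 / 32 * D.p ^ 2 ≤ nL D.precision ∧ nL D.precision ≤ 4 * D.p ^ 2 := by
  obtain ⟨s, hs⟩ : ∃ s, 2 * I + 1 = (I + I / 2) + s := ⟨2 * I + 1 - (I + I / 2), by omega⟩
  have hIs : I ^ 2 ≤ (2 * s) ^ 2 := Nat.pow_le_pow_left (by omega) 2
  have hlower := (D.denseFrom_precision hτ hd hI hdesign).sq_le_nL hs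
  have hupper : nL D.precision ≤ (4 * I) * (4 * I) :=
    (nL_le _).trans (Nat.mul_le_mul (by omega) (by omega))
  rify at hIs hlower hupper
  rw [p]
  constructor <;> linarith

lemma costSLA_precision_bounds (D : Model I N) (hτ : 0 < D.τ) (hd : 2 ≤ d) (hI : d + 1 ≤ I)
    (hdesign : ∀ i j, D.cooc i j = worstDesign d I i j) :
    1 / 200 * D.p ^ 3 ≤ costSLA D.precision ∧ costSLA D.precision ≤ 6 * D.p ^ 3 := by
  obtain ⟨s, hs⟩ : ∃ s, 2 * I + 1 = (I + I / 2) + s := ⟨2 * I + 1 - (I + I / 2), by omega⟩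
  have hIs : I ^ 3 ≤ (2 * s) ^ 3 := Nat.pow_le_pow_left (by omega) 3
  have hlower := (D.denseFrom_precision hτ hd hI hdesign).cube_le_costSLA hs
  have hupper : costSLA D.precision ≤ (3 * I) * ((3 * I) * (5 * I)) :=
    (costSLA_le _).trans
      (Nat.mul_le_mul (by omega) (Nat.mul_le_mul (by omega) (by omega)))
  rify at hIs hlower hupper
  rw [p]
  constructor <;> nlinarith

end Model

/-! ### Values and costs of the block programs -/

lemma foldl_update_add {ι β : Type} [DecidableEq ι] (f g : β → ℝ) (κ : β → ι) (l : List β)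
    (c s : ι → ℝ) :
    l.foldl (fun (cs : (ι → ℝ) × (ι → ℝ)) n =>
      (Function.update cs.1 (κ n) (cs.1 (κ n) + f n),
        Function.update cs.2 (κ n) (cs.2 (κ n) + g n))) (c, s) =
      (fun i => c i + (l.map fun n => if κ n = i then f n else 0).sum,
        fun i => s i + (l.map fun n => if κ n = i then g n else 0).sum) := by
  have hupdate (c : ι → ℝ) (x : ℝ) (i j : ι) :
      Function.update c i (c i + x) j = c j + if i = j then x else 0 := by
    rcases eq_or_ne i j with rfl | hij <;> simp [*, Ne.symm]
  induction l generalizing c s with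
  | nil => simp
  | cons n l ih => simp [ih, hupdate, add_assoc]

lemma foldl_add_pair {β : Type} (f g : β → ℝ) (l : List β) (p q : ℝ) :
    l.foldl (fun (ph : ℝ × ℝ) n => (ph.1 + f n, ph.2 + g n)) (p, q) =
      (p + (l.map f).sum, q + (l.map g).sum) := by
  induction l generalizing p q with
  | nil => simp
  | cons n l ih => simp [ih, add_assoc]

lemma foldl_update_apply {ι : Type} [DecidableEq ι] (x : ι → ℝ) (l : List ι) (a : ι → ℝ) (i : ι) :
    l.foldl (fun (a : ι → ℝ) i => Function.update a i (x i)) a i =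
      if i ∈ l then x i else a i := by
  induction l generalizing a with
  | nil => simp
  | cons j l ih =>
    rw [List.foldl_cons, ih]
    rcases eq_or_ne i j with rfl | hij <;> simp [*]

namespace Model

variable {I N : ℕ}

/-- Sum of the residuals at level `i` of factor `k`, given the effects `b` of the other factor. -/
noncomputable def resSum (D : Model I N) (k : Fin 2) (b : Fin I → ℝ) (i : Fin I) : ℝ :=
  ∑ n, if D.lev k n = i then D.y n - b (D.lev k.rev n) else 0

/-- Precision of the effect of level `i` of factor `k` given all other parameters. -/
noncomputable def levelPrec (D : Model I N) (k : Fin 2) (i : Fin I) : ℝ :=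
  D.τf k + D.τ * D.occ k i

/-- Precision that each observation at level `i` of factor `k` contributes to `a⁽⁰⁾` once the effect
of that level is integrated out. -/
noncomputable def levelWeight (D : Model I N) (k : Fin 2) (i : Fin I) : ℝ :=
  D.τ * D.τf k / D.levelPrec k i

/-- Precision of `a⁽⁰⁾` given the effects of the factor `k.rev`. -/
noncomputable def globalPrec (D : Model I N) (k : Fin 2) : ℝ :=
  D.tpr + ∑ i, D.levelWeight k i * D.occ k i

/-- Mean of `a⁽⁰⁾` given the effects `b` of the factor `k.rev`. -/
noncomputable def globalMean (D : Model I N) (k : Fin 2) (b : Fin I → ℝ) : ℝ :=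
  (D.tpr * D.μpr + ∑ i, D.levelWeight k i * D.resSum k b i) / D.globalPrec k

/-- Mean of the effect of level `i` of factor `k` given `a⁽⁰⁾ = a₀` and the effects `b` of the other
factor. -/
noncomputable def levelMean (D : Model I N) (k : Fin 2) (b : Fin I → ℝ) (a₀ : ℝ) (i : Fin I) : ℝ :=
  D.τ * (D.resSum k b i - D.occ k i * a₀) / D.levelPrec k i

/-- The block `(a⁽⁰⁾, a⁽ᵏ⁾)` obtained from the noise `z`, given the effects `b` of the other
factor. -/
noncomputable def blockDraw (D : Model I N) (k : Fin 2) (b : Fin I → ℝ) (z : Noise I) :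
    ℝ × (Fin I → ℝ) :=
  (D.globalMean k b + z.1 / √(D.globalPrec k), fun i =>
    D.levelMean k b (D.globalMean k b + z.1 / √(D.globalPrec k)) i + z.2 i / √(D.levelPrec k i))

lemma val_levelSums (D : Model I N) (k : Fin 2) (θ : State I) :
    (D.levelSums k θ).val = (fun i => (D.occ k i : ℝ), D.resSum k (θ.2 k.rev)) := by
  rw [levelSums, Counted.val_foldlM]
  simp only [Counted.val_bind, Counted.val_op, Counted.val_pure]
  rw [show ((0, 0) : (Fin I → ℝ) × (Fin I → ℝ)) = (fun _ => 0, fun _ => 0) from rfl,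
    foldl_update_add (fun _ => 1) (fun n => D.y n - θ.2 k.rev (D.lev k.rev n)) (D.lev k)]
  simp only [zero_add, ← Fin.sum_univ_def, Finset.sum_boole]
  rfl

lemma ops_levelSums (D : Model I N) (k : Fin 2) (θ : State I) : (D.levelSums k θ).ops = 3 * N := by
  rw [levelSums, Counted.ops_foldlM_const (c := 3) _ (by intros; rfl), List.length_finRange]

lemma val_globalParams (D : Model I N) (k : Fin 2) (b : Fin I → ℝ) :
    (D.globalParams k (fun i => (D.occ k i : ℝ)) (D.resSum k b)).val =
      (D.globalPrec k, D.tpr * D.μpr + ∑ i, D.levelWeight k i * D.resSum k b i) := by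
  simp only [globalParams, Counted.val_bind, Counted.val_op, Counted.val_foldlM, Counted.val_pure]
  refine (foldl_add_pair (fun i => D.levelWeight k i * D.occ k i)
    (fun i => D.levelWeight k i * D.resSum k b i) _ _ _).trans ?_
  simp only [← Fin.sum_univ_def, globalPrec]

lemma ops_globalParams (D : Model I N) (k : Fin 2) (c s : Fin I → ℝ) :
    (D.globalParams k c s).ops = 1 + 8 * I := by
  rw [globalParams, Counted.ops_bind, Counted.ops_foldlM_const (c := 8) _ (by intros; rfl),
    List.length_finRange, Counted.ops_op]

lemma val_levelDraws (D : Model I N) (k : Fin 2) (b : Fin I → ℝ) (a₀ : ℝ) (z : Fin I → ℝ) :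
    (D.levelDraws k (fun i => (D.occ k i : ℝ)) (D.resSum k b) a₀ z).val =
      fun i => D.levelMean k b a₀ i + z i / √(D.levelPrec k i) := by
  rw [levelDraws, Counted.val_foldlM]
  simp only [Counted.val_bind, Counted.val_op, Counted.val_pure, normalDraw]
  ext i
  exact (foldl_update_apply (fun i => D.levelMean k b a₀ i + z i / √(D.levelPrec k i)) _ _ i).trans
    (if_pos (List.mem_finRange i))

lemma ops_levelDraws (D : Model I N) (k : Fin 2) (c s : Fin I → ℝ) (a₀ : ℝ) (z : Fin I → ℝ) :
    (D.levelDraws k c s a₀ z).ops = 10 * I := by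
  rw [levelDraws, Counted.ops_foldlM_const (c := 10) _ (by intros; rfl), List.length_finRange]

lemma val_blockProgram (D : Model I N) (k : Fin 2) (θ : State I) (z : Noise I) :
    (D.blockProgram k θ z).val = assemble k (D.blockDraw k (θ.2 k.rev) z) (θ.2 k.rev) := by
  simp only [blockProgram, Counted.val_bind, Counted.val_pure, val_levelSums, val_globalParams,
    val_levelDraws, normalDraw, Counted.val_op]
  rfl

lemma ops_blockProgram (D : Model I N) (k : Fin 2) (θ : State I) (z : Noise I) :
    (D.blockProgram k θ z).ops = 3 * N + 18 * I + 6 := by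
  simp only [blockProgram, Counted.ops_bind, Counted.ops_pure, ops_levelSums, ops_globalParams,
    ops_levelDraws, normalDraw, Counted.ops_op]
  ring

lemma costPerIteration_eq (D : Model I N) :
    D.costPerIteration = ((2 * (3 * N + 18 * I + 6) : ℕ) : ℝ≥0∞) := by
  simp only [costPerIteration, gibbsProgram, Counted.ops_bind, ops_blockProgram, iSup_const,
    two_mul]

/-! ### Completing the squares -/

/-- All conditional precisions are positive, so that the block updates are nondegenerate normal
draws. -/
structure Nondegenerate (D : Model I N) : Prop where
  levelPrec_pos : ∀ k i, 0 < D.levelPrec k i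
  globalPrec_pos : ∀ k, 0 < D.globalPrec k

lemma nondegenerate_of_pos (D : Model I N) (hτ : 0 < D.τ) (hf : ∀ k, 0 < D.τf k) (ht : 0 ≤ D.tpr)
    (hN : 0 < N) : D.Nondegenerate := by
  have hprec (k i) : 0 < D.levelPrec k i :=
    add_pos_of_pos_of_nonneg (hf k) (mul_nonneg hτ.le (Nat.cast_nonneg _))
  have hweight (k i) : 0 < D.levelWeight k i := div_pos (mul_pos hτ (hf k)) (hprec k i)
  refine ⟨hprec, fun k => add_pos_of_nonneg_of_pos ht ?_⟩
  have hocc : 0 < D.occ k (D.lev k ⟨0, hN⟩) := Finset.card_pos.2 ⟨⟨0, hN⟩, by simp⟩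
  exact Finset.sum_pos' (fun i _ => mul_nonneg (hweight k i).le (Nat.cast_nonneg _))
    ⟨_, Finset.mem_univ _, mul_pos (hweight k _) (Nat.cast_pos.2 hocc)⟩

/-- `-2` times the part of the log posterior density that depends on the effects `b` of factor
`k.rev` only, once the square in `(a⁽⁰⁾, a⁽ᵏ⁾)` is completed. -/
noncomputable def marginalExponent (D : Model I N) (k : Fin 2) (b : Fin I → ℝ) : ℝ :=
  D.tpr * D.μpr ^ 2 + ∑ j, D.τf k.rev * b j ^ 2 + D.τ * ∑ n, (D.y n - b (D.lev k.rev n)) ^ 2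
    - ∑ i, D.τ ^ 2 * D.resSum k b i ^ 2 / D.levelPrec k i
    - D.globalPrec k * D.globalMean k b ^ 2

lemma sum_eq_sum_levels (D : Model I N) (k : Fin 2) (f : Fin N → Fin I → ℝ) :
    ∑ n, f n (D.lev k n) = ∑ i, ∑ n, if D.lev k n = i then f n i else 0 := by
  rw [Finset.sum_comm]
  simp

lemma sum_sq_residuals (D : Model I N) (k : Fin 2) (b : Fin I → ℝ) (a₀ : ℝ) (a : Fin I → ℝ) :
    ∑ n, (D.y n - (a₀ + a (D.lev k n) + b (D.lev k.rev n))) ^ 2 =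
      ∑ n, (D.y n - b (D.lev k.rev n)) ^ 2 +
        ∑ i, (D.occ k i * (a₀ + a i) ^ 2 - 2 * D.resSum k b i * (a₀ + a i)) := by
  have hexpand (n) : (D.y n - (a₀ + a (D.lev k n) + b (D.lev k.rev n))) ^ 2 =
      (D.y n - b (D.lev k.rev n)) ^ 2 +
        ((a₀ + a (D.lev k n)) ^ 2 - 2 * (D.y n - b (D.lev k.rev n)) * (a₀ + a (D.lev k n))) := by
    ring
  have hocc (i) : (D.occ k i : ℝ) = ∑ n, if D.lev k n = i then 1 else 0 := by simp [occ]
  rw [Finset.sum_congr rfl fun n _ => hexpand n, Finset.sum_add_distrib, D.sum_eq_sum_levels k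
    fun n i => (a₀ + a i) ^ 2 - 2 * (D.y n - b (D.lev k.rev n)) * (a₀ + a i)]
  congr 1
  refine Finset.sum_congr rfl fun i _ => ?_
  rw [hocc, resSum, Finset.sum_mul, Finset.mul_sum, Finset.sum_mul, ← Finset.sum_sub_distrib]
  refine Finset.sum_congr rfl fun n _ => ?_
  split_ifs <;> ring

lemma complete_level_square (D : Model I N) {k : Fin 2} {i : Fin I} (hprec : D.levelPrec k i ≠ 0)
    (b : Fin I → ℝ) (a₀ x : ℝ) :
    D.τf k * x ^ 2 + D.τ * (D.occ k i * (a₀ + x) ^ 2 - 2 * D.resSum k b i * (a₀ + x)) =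
      D.levelPrec k i * (x - D.levelMean k b a₀ i) ^ 2 + D.levelWeight k i * D.occ k i * a₀ ^ 2
        - 2 * a₀ * (D.levelWeight k i * D.resSum k b i)
        - D.τ ^ 2 * D.resSum k b i ^ 2 / D.levelPrec k i := by
  rw [levelMean, levelWeight, show D.τf k = D.levelPrec k i - D.τ * D.occ k i by
    rw [levelPrec]; ring]
  field_simp
  ring

lemma complete_global_square (D : Model I N) {k : Fin 2} (hprec : D.globalPrec k ≠ 0)
    (b : Fin I → ℝ) (a₀ : ℝ) :
    D.globalPrec k * (a₀ - D.globalMean k b) ^ 2 =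
      D.tpr * a₀ ^ 2 + ∑ i, D.levelWeight k i * D.occ k i * a₀ ^ 2
        - 2 * a₀ * D.tpr * D.μpr - ∑ i, 2 * a₀ * (D.levelWeight k i * D.resSum k b i)
        + D.globalPrec k * D.globalMean k b ^ 2 := by
  have hmean : D.globalPrec k * D.globalMean k b =
      D.tpr * D.μpr + ∑ i, D.levelWeight k i * D.resSum k b i := mul_div_cancel₀ _ hprec
  rw [← Finset.sum_mul, ← Finset.mul_sum]
  have hprec_eq : D.globalPrec k = D.tpr + ∑ i, D.levelWeight k i * D.occ k i := rfl
  linear_combination a₀ ^ 2 * hprec_eq - 2 * a₀ * hmean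

lemma complete_squares (D : Model I N) (hD : D.Nondegenerate) (k : Fin 2) (b : Fin I → ℝ) (a₀ : ℝ)
    (a : Fin I → ℝ) :
    D.tpr * (a₀ - D.μpr) ^ 2 + (∑ i, D.τf k * a i ^ 2 + ∑ i, D.τf k.rev * b i ^ 2) +
      D.τ * ∑ n, (D.y n - (a₀ + a (D.lev k n) + b (D.lev k.rev n))) ^ 2 =
    D.globalPrec k * (a₀ - D.globalMean k b) ^ 2 +
      ∑ i, D.levelPrec k i * (a i - D.levelMean k b a₀ i) ^ 2 + D.marginalExponent k b := by
  have hlevels := Finset.sum_congr (rfl : (Finset.univ : Finset (Fin I)) = _) fun i _ =>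
    D.complete_level_square (hD.levelPrec_pos k i).ne' b a₀ (a i)
  rw [Finset.sum_add_distrib, Finset.sum_sub_distrib, Finset.sum_sub_distrib,
    Finset.sum_add_distrib, ← Finset.mul_sum _ _ D.τ] at hlevels
  rw [sum_sq_residuals, D.complete_global_square (hD.globalPrec_pos k).ne', marginalExponent]
  linear_combination hlevels

lemma sum_assemble_sq (D : Model I N) (k : Fin 2) (u : ℝ × (Fin I → ℝ)) (b : Fin I → ℝ) :
    ∑ l, ∑ i, D.τf l * (assemble k u b).2 l i ^ 2 =
      ∑ i, D.τf k * u.2 i ^ 2 + ∑ i, D.τf k.rev * b i ^ 2 := by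
  fin_cases k
  · simp [assemble, Fin.sum_univ_two]
  · simp [assemble, Fin.sum_univ_two, add_comm]

lemma predictor_assemble (D : Model I N) (k : Fin 2) (u : ℝ × (Fin I → ℝ)) (b : Fin I → ℝ)
    (n : Fin N) :
    (assemble k u b).1 + (assemble k u b).2 0 (D.lev 0 n) + (assemble k u b).2 1 (D.lev 1 n) =
      u.1 + u.2 (D.lev k n) + b (D.lev k.rev n) := by
  fin_cases k
  · simp [assemble]
  · simp [assemble, add_right_comm]

lemma postWeight_assemble (D : Model I N) (hD : D.Nondegenerate) (k : Fin 2)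
    (u : ℝ × (Fin I → ℝ)) (b : Fin I → ℝ) :
    D.postWeight (assemble k u b) = Real.exp (-D.marginalExponent k b / 2) *
      (Real.exp (-(D.globalPrec k * (u.1 - D.globalMean k b) ^ 2) / 2) *
        ∏ i, Real.exp (-(D.levelPrec k i * (u.2 i - D.levelMean k b u.1 i) ^ 2) / 2)) := by
  rw [postWeight, ← Real.exp_sum, ← Real.exp_sum, ← Real.exp_add, ← Real.exp_add, ← Real.exp_add]
  simp only [sum_assemble_sq, predictor_assemble, ← Finset.sum_div, Finset.sum_neg_distrib,
    neg_mul, ← Finset.mul_sum _ _ D.τ]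
  congr 1
  simp only [assemble]
  linear_combination (-1 / 2) * D.complete_squares hD k b u.1 u.2

end Model

/-! ### Lebesgue integrals of products and of normal densities -/

section ProductMeasure

variable {ι : Type*} [Fintype ι] {E : ι → Type*} {f : ∀ i, E i → ℝ≥0∞}

lemma indicator_pi_fintype_prod (s : ∀ i, Set (E i)) (x : ∀ i, E i) :
    (Set.univ.pi s).indicator (fun x => ∏ i, f i (x i)) x = ∏ i, (s i).indicator (f i) (x i) := by
  by_cases hx : x ∈ Set.univ.pi s
  · rw [Set.indicator_of_mem hx]
    exact Finset.prod_congr rfl fun i _ => (Set.indicator_of_mem (hx i trivial) _).symm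
  · obtain ⟨i, hi⟩ : ∃ i, x i ∉ s i := by simpa using hx
    rw [Set.indicator_of_notMem hx]
    exact (Finset.prod_eq_zero (Finset.mem_univ i) (Set.indicator_of_notMem hi _)).symm

variable [∀ i, MeasurableSpace (E i)]

lemma measurable_prod_apply (hf : ∀ i, Measurable (f i)) :
    Measurable fun x : ∀ i, E i => ∏ i, f i (x i) :=
  Finset.measurable_fun_prod _ fun i _ => (hf i).comp (measurable_pi_apply i)

variable {μ : ∀ i, Measure (E i)} [∀ i, SigmaFinite (μ i)]

lemma lmarginal_fintype_prod [DecidableEq ι] (hf : ∀ i, Measurable (f i)) (s : Finset ι) :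
    (∫⋯∫⁻_s, (fun x : ∀ i, E i => ∏ i, f i (x i)) ∂μ) =
      fun x => (∏ i ∈ s, ∫⁻ t, f i t ∂μ i) * ∏ i ∈ sᶜ, f i (x i) := by
  induction s using Finset.induction_on with
  | empty => simp
  | insert j s hj ih =>
    funext x
    have hfactor (t : E j) : ∏ i ∈ sᶜ, f i (Function.update x j t i) =
        f j t * ∏ i ∈ (insert j s)ᶜ, f i (x i) := by
      rw [← Finset.mul_prod_erase _ _ (Finset.mem_compl.2 hj), ← Finset.compl_insert,
        Function.update_self]
      congr 1
      refine Finset.prod_congr rfl fun i hi => ?_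
      rw [Function.update_of_ne]
      rintro rfl
      simp at hi
    rw [lmarginal_insert _ (measurable_prod_apply hf) hj, ih]
    simp only [hfactor]
    rw [lintegral_const_mul _ ((hf j).mul_const _), lintegral_mul_const _ (hf j),
      Finset.prod_insert hj]
    ring

lemma lintegral_fintype_prod_eq_prod (hf : ∀ i, Measurable (f i)) :
    ∫⁻ x, ∏ i, f i (x i) ∂Measure.pi μ = ∏ i, ∫⁻ t, f i t ∂μ i := by
  classical
  rcases isEmpty_or_nonempty (∀ i, E i) with hE | ⟨⟨x⟩⟩
  · obtain ⟨i, hi⟩ := isEmpty_pi.1 hE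
    rw [lintegral_of_isEmpty, Finset.prod_eq_zero (Finset.mem_univ i) (lintegral_of_isEmpty _ _)]
  · simpa using congrFun (lmarginal_fintype_prod (μ := μ) hf Finset.univ) x

lemma pi_withDensity (hf : ∀ i, Measurable (f i)) [∀ i, SigmaFinite ((μ i).withDensity (f i))] :
    Measure.pi (fun i => (μ i).withDensity (f i)) =
      (Measure.pi μ).withDensity fun x => ∏ i, f i (x i) := by
  refine Measure.pi_eq fun s hs => ?_
  rw [withDensity_apply _ (MeasurableSet.univ_pi hs),
    ← lintegral_indicator (MeasurableSet.univ_pi hs)]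
  simp_rw [indicator_pi_fintype_prod]
  rw [lintegral_fintype_prod_eq_prod fun i => (hf i).indicator (hs i)]
  exact Finset.prod_congr rfl fun i _ => by
    rw [lintegral_indicator (hs i), withDensity_apply _ (hs i)]

end ProductMeasure

/-- The unnormalized density of the normal law with precision `v` and mean `m`. -/
noncomputable def gaussWeight (v m x : ℝ) : ℝ≥0∞ :=
  ENNReal.ofReal (Real.exp (-(v * (x - m) ^ 2) / 2))

/-- The total mass of `gaussWeight v m`. -/
noncomputable def gaussMass (v : ℝ) : ℝ≥0∞ := ENNReal.ofReal (√(2 * Real.pi / v))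

lemma gaussMass_lt_top (v : ℝ) : gaussMass v < ∞ := ENNReal.ofReal_lt_top

lemma measurable_gaussWeight (v m : ℝ) : Measurable (gaussWeight v m) := by
  unfold gaussWeight
  fun_prop

lemma map_standardize_gaussianReal {v : ℝ} (hv : 0 < v) (m : ℝ) :
    (gaussianReal 0 1).map (fun z => m + z / √v) = gaussianReal m (Real.toNNReal v⁻¹) := by
  rw [show (fun z : ℝ => m + z / √v) = (fun z => m + z) ∘ fun z => z / √v from rfl,
    ← Measure.map_map (by fun_prop) (by fun_prop), gaussianReal_map_div_const,
    gaussianReal_map_const_add]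
  congr 1
  · simp
  · ext
    simp [Real.sq_sqrt hv.le, hv.le]

lemma withDensity_gaussWeight {v : ℝ} (hv : 0 < v) (m : ℝ) :
    (volume : Measure ℝ).withDensity (gaussWeight v m) =
      gaussMass v • (gaussianReal 0 1).map fun z => m + z / √v := by
  have hvar : Real.toNNReal v⁻¹ ≠ 0 := by simpa using hv
  rw [map_standardize_gaussianReal hv, gaussianReal_of_var_ne_zero _ hvar,
    ← withDensity_smul _ (measurable_gaussianPDF _ _)]
  congr 1
  ext x
  rw [Pi.smul_apply, smul_eq_mul, gaussMass, gaussianPDF, ← ENNReal.ofReal_mul (by positivity),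
    gaussianPDFReal, Real.coe_toNNReal _ (by positivity : (0 : ℝ) ≤ v⁻¹), ← mul_assoc,
    ← div_eq_mul_inv (2 * Real.pi) v, mul_inv_cancel₀ (by positivity), one_mul, gaussWeight]
  congr 2
  field_simp

lemma isFiniteMeasure_withDensity_gaussWeight {v : ℝ} (hv : 0 < v) (m : ℝ) :
    IsFiniteMeasure ((volume : Measure ℝ).withDensity (gaussWeight v m)) := by
  rw [withDensity_gaussWeight hv]
  exact Measure.smul_finite _ (gaussMass_lt_top _).ne

lemma lintegral_gaussWeight_mul {v : ℝ} (hv : 0 < v) (m : ℝ) {G : ℝ → ℝ≥0∞} (hG : Measurable G) :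
    ∫⁻ x, gaussWeight v m x * G x = gaussMass v * ∫⁻ z, G (m + z / √v) ∂(gaussianReal 0 1) := by
  rw [← lintegral_map hG (by fun_prop : Measurable fun z : ℝ => m + z / √v), ← smul_eq_mul,
    ← lintegral_smul_measure, ← withDensity_gaussWeight hv,
    lintegral_withDensity_eq_lintegral_mul _ (measurable_gaussWeight v m) hG]
  rfl

lemma lintegral_gaussWeight {v : ℝ} (hv : 0 < v) (m : ℝ) :
    ∫⁻ x, gaussWeight v m x = gaussMass v := by
  simpa using lintegral_gaussWeight_mul hv m (G := fun _ => 1) measurable_const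

section ProductGaussian

variable {ι : Type*} [Fintype ι] {v : ι → ℝ}

lemma withDensity_prod_gaussWeight (hv : ∀ i, 0 < v i) (m : ι → ℝ) :
    (volume : Measure (ι → ℝ)).withDensity (fun x => ∏ i, gaussWeight (v i) (m i) (x i)) =
      (∏ i, gaussMass (v i)) •
        (Measure.pi fun _ => gaussianReal 0 1).map fun z i => m i + z i / √(v i) := by
  have : ∀ i, IsFiniteMeasure ((volume : Measure ℝ).withDensity (gaussWeight (v i) (m i))) :=
    fun i => isFiniteMeasure_withDensity_gaussWeight (hv i) (m i)
  have : ∀ i, IsProbabilityMeasure ((gaussianReal 0 1).map fun z : ℝ => m i + z / √(v i)) :=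
    fun i => Measure.isProbabilityMeasure_map (by fun_prop)
  rw [volume_pi, ← pi_withDensity fun i => measurable_gaussWeight (v i) (m i),
    Measure.pi_map_pi (f := fun i z => m i + z / √(v i)) (fun i => by fun_prop)]
  refine Measure.pi_eq fun s _ => ?_
  rw [Measure.smul_apply, Measure.pi_pi, smul_eq_mul, ← Finset.prod_mul_distrib]
  refine Finset.prod_congr rfl fun i _ => ?_
  rw [withDensity_gaussWeight (hv i), Measure.smul_apply, smul_eq_mul]

lemma lintegral_prod_gaussWeight_mul (hv : ∀ i, 0 < v i) (m : ι → ℝ) {G : (ι → ℝ) → ℝ≥0∞}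
    (hG : Measurable G) :
    ∫⁻ x, (∏ i, gaussWeight (v i) (m i) (x i)) * G x =
      (∏ i, gaussMass (v i)) *
        ∫⁻ z, G (fun i => m i + z i / √(v i)) ∂(Measure.pi fun _ => gaussianReal 0 1) := by
  rw [← lintegral_map hG (by fun_prop : Measurable fun (z : ι → ℝ) i => m i + z i / √(v i)),
    ← smul_eq_mul, ← lintegral_smul_measure, ← withDensity_prod_gaussWeight hv,
    lintegral_withDensity_eq_lintegral_mul _
      (measurable_prod_apply fun i => measurable_gaussWeight (v i) (m i)) hG]
  rfl

end ProductGaussian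

namespace Model

variable {I N : ℕ}

/-! ### The posterior law in block coordinates -/

/-- A state in block coordinates: the effects of factor `k.rev`, and the block of factor `k`. -/
def toBlocks (k : Fin 2) (θ : State I) : (Fin I → ℝ) × (ℝ × (Fin I → ℝ)) :=
  (θ.2 k.rev, (θ.1, θ.2 k))

lemma measurable_toBlocks (k : Fin 2) : Measurable (toBlocks (I := I) k) := by
  unfold toBlocks
  fun_prop

lemma measurable_assemble (k : Fin 2) :
    Measurable fun x : (ℝ × (Fin I → ℝ)) × (Fin I → ℝ) => assemble k x.1 x.2 := by
  unfold assemble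
  refine (measurable_fst.comp measurable_fst).prodMk (measurable_pi_lambda _ fun l => ?_)
  split_ifs
  · exact measurable_snd.comp measurable_fst
  · exact measurable_snd

lemma measurable_assemble_left (k : Fin 2) (b : Fin I → ℝ) :
    Measurable fun u : ℝ × (Fin I → ℝ) => assemble k u b :=
  (measurable_assemble k).comp (measurable_id.prodMk measurable_const)

lemma assemble_toBlocks (k : Fin 2) (θ : State I) :
    assemble k (toBlocks k θ).2 (toBlocks k θ).1 = θ := by
  unfold assemble toBlocks
  ext l
  · rfl
  · fin_cases k <;> fin_cases l <;> simp

lemma measurePreserving_toBlocks (k : Fin 2) :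
    MeasurePreserving (toBlocks (I := I) k) volume volume := by
  have hfactors : MeasurePreserving (Prod.map id (MeasurableEquiv.piFinTwo fun _ => (Fin I → ℝ)))
      (volume : Measure (State I)) volume :=
    (MeasurePreserving.id _).prod (volume_preserving_piFinTwo _)
  have hassoc :=
    (volume_preserving_prodAssoc (α₁ := ℝ) (β₁ := Fin I → ℝ) (γ₁ := Fin I → ℝ)).symm
  have hpair := Measure.measurePreserving_swap.comp hassoc
  fin_cases k
  · exact hpair.comp hfactors
  · have hswap : MeasurePreserving (Prod.map id Prod.swap)
        (volume : Measure (ℝ × ((Fin I → ℝ) × (Fin I → ℝ)))) volume :=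
      (MeasurePreserving.id _).prod Measure.measurePreserving_swap
    exact (hpair.comp hswap).comp hfactors

lemma measurable_postWeight (D : Model I N) : Measurable D.postWeight := by
  unfold postWeight
  exact Measurable.mul (by fun_prop) (Finset.measurable_fun_prod _ fun n _ => by fun_prop)

lemma measurable_resSum (D : Model I N) (k : Fin 2) (i : Fin I) :
    Measurable fun b : Fin I → ℝ => D.resSum k b i := by
  unfold resSum
  refine Finset.measurable_fun_sum _ fun n _ => ?_
  split_ifs <;> fun_prop

lemma measurable_globalMean (D : Model I N) (k : Fin 2) :
    Measurable fun b : Fin I → ℝ => D.globalMean k b := by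
  have hres := D.measurable_resSum k
  unfold globalMean
  fun_prop

lemma measurable_levelMean (D : Model I N) (k : Fin 2) (i : Fin I) :
    Measurable fun p : (Fin I → ℝ) × ℝ => D.levelMean k p.1 p.2 i := by
  have hres := D.measurable_resSum k i
  unfold levelMean
  fun_prop

lemma measurable_blockDraw (D : Model I N) (k : Fin 2) :
    Measurable fun p : (Fin I → ℝ) × Noise I => D.blockDraw k p.1 p.2 := by
  have hmean := D.measurable_globalMean k
  have hglobal : Measurable fun p : (Fin I → ℝ) × Noise I =>
      D.globalMean k p.1 + p.2.1 / √(D.globalPrec k) := by fun_prop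
  unfold blockDraw
  exact hglobal.prodMk (measurable_pi_lambda _ fun i =>
    ((D.measurable_levelMean k i).comp (measurable_fst.prodMk hglobal)).add (by fun_prop))

lemma measurable_blockDraw_left (D : Model I N) (k : Fin 2) (b : Fin I → ℝ) :
    Measurable (D.blockDraw k b) :=
  (D.measurable_blockDraw k).of_uncurry_left

instance : IsProbabilityMeasure (noiseLaw I) := by unfold noiseLaw; infer_instance

/-- The density of the effects of factor `k.rev`, up to normalization. -/
noncomputable def marginalWeight (D : Model I N) (k : Fin 2) (b : Fin I → ℝ) : ℝ≥0∞ :=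
  ENNReal.ofReal (Real.exp (-D.marginalExponent k b / 2)) *
    (gaussMass (D.globalPrec k) * ∏ i, gaussMass (D.levelPrec k i))

lemma ofReal_postWeight_assemble (D : Model I N) (hD : D.Nondegenerate) (k : Fin 2)
    (u : ℝ × (Fin I → ℝ)) (b : Fin I → ℝ) :
    ENNReal.ofReal (D.postWeight (assemble k u b)) =
      ENNReal.ofReal (Real.exp (-D.marginalExponent k b / 2)) *
        (gaussWeight (D.globalPrec k) (D.globalMean k b) u.1 *
          ∏ i, gaussWeight (D.levelPrec k i) (D.levelMean k b u.1 i) (u.2 i)) := by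
  rw [D.postWeight_assemble hD, ENNReal.ofReal_mul (Real.exp_nonneg _),
    ENNReal.ofReal_mul (Real.exp_nonneg _),
    ENNReal.ofReal_prod_of_nonneg fun _ _ => Real.exp_nonneg _]
  rfl

lemma lintegral_postWeight_levels (D : Model I N) (hD : D.Nondegenerate) (k : Fin 2)
    (b : Fin I → ℝ) (a₀ : ℝ) {G : (Fin I → ℝ) → ℝ≥0∞} (hG : Measurable G) :
    ∫⁻ a, ENNReal.ofReal (D.postWeight (assemble k (a₀, a) b)) * G a =
      gaussWeight (D.globalPrec k) (D.globalMean k b) a₀ *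
      (ENNReal.ofReal (Real.exp (-D.marginalExponent k b / 2)) *
        ((∏ i, gaussMass (D.levelPrec k i)) *
          ∫⁻ z, G (fun i => D.levelMean k b a₀ i + z i / √(D.levelPrec k i))
            ∂(Measure.pi fun _ => gaussianReal 0 1))) := by
  have hmeas : Measurable fun a : Fin I → ℝ =>
      (∏ i, gaussWeight (D.levelPrec k i) (D.levelMean k b a₀ i) (a i)) * G a :=
    (measurable_prod_apply fun i => measurable_gaussWeight _ _).mul hG
  rw [← lintegral_prod_gaussWeight_mul (hD.levelPrec_pos k) (D.levelMean k b a₀) hG,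
    ← lintegral_const_mul _ hmeas, ← lintegral_const_mul _ (hmeas.const_mul _)]
  refine lintegral_congr fun a => ?_
  rw [D.ofReal_postWeight_assemble hD]
  ring

lemma lintegral_postWeight_block (D : Model I N) (hD : D.Nondegenerate) (k : Fin 2)
    (b : Fin I → ℝ) {G : ℝ × (Fin I → ℝ) → ℝ≥0∞} (hG : Measurable G) :
    ∫⁻ u, ENNReal.ofReal (D.postWeight (assemble k u b)) * G u =
      D.marginalWeight k b * ∫⁻ z, G (D.blockDraw k b z) ∂(noiseLaw I) := by
  have hweight : Measurable fun u => ENNReal.ofReal (D.postWeight (assemble k u b)) * G u :=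
    (D.measurable_postWeight.comp (measurable_assemble_left k b)).ennreal_ofReal.mul hG
  have hdraw : Measurable fun z => G (D.blockDraw k b z) :=
    hG.comp (D.measurable_blockDraw_left k b)
  have hlevels : Measurable fun p : ℝ × (Fin I → ℝ) =>
      G (p.1, fun i => D.levelMean k b p.1 i + p.2 i / √(D.levelPrec k i)) := by
    refine hG.comp (measurable_fst.prodMk (measurable_pi_lambda _ fun i => ?_))
    have hmean : Measurable fun a₀ => D.levelMean k b a₀ i := by
      unfold levelMean
      fun_prop
    exact (hmean.comp measurable_fst).add (by fun_prop)
  have hinner := hlevels.lintegral_prod_right' (ν := Measure.pi fun _ => gaussianReal 0 1)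
  have hinner_draw := hinner.comp (by fun_prop : Measurable fun z : ℝ =>
    D.globalMean k b + z / √(D.globalPrec k))
  simp only [Function.comp_def] at hinner_draw
  rw [Measure.volume_eq_prod, lintegral_prod _ hweight.aemeasurable, noiseLaw,
    lintegral_prod _ hdraw.aemeasurable, lintegral_congr fun a₀ =>
      D.lintegral_postWeight_levels hD k b a₀ (G := fun a => G (a₀, a))
        (hG.comp measurable_prodMk_left),
    lintegral_gaussWeight_mul (hD.globalPrec_pos k) _ ((hinner.const_mul _).const_mul _),
    lintegral_const_mul _ (hinner_draw.const_mul _), lintegral_const_mul _ hinner_draw,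
    marginalWeight]
  simp only [blockDraw]
  ring

end Model

/-! ### Moments of the posterior law -/

lemma lintegral_gaussWeight_mul_snd {α : Type*} [MeasurableSpace α] {μ : Measure α} [SFinite μ]
    {v : ℝ} (hv : 0 < v) {m : α → ℝ} (hm : Measurable m) {F : α → ℝ≥0∞} (hF : Measurable F) :
    ∫⁻ x, gaussWeight v (m x.2) x.1 * F x.2 ∂((volume : Measure ℝ).prod μ) =
      gaussMass v * ∫⁻ a, F a ∂μ := by
  have hmeas : Measurable fun x : ℝ × α => gaussWeight v (m x.2) x.1 * F x.2 := by
    unfold gaussWeight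
    fun_prop
  rw [lintegral_prod_symm _ hmeas.aemeasurable, ← lintegral_const_mul _ hF]
  refine lintegral_congr fun a => ?_
  dsimp only
  rw [lintegral_mul_const _ (measurable_gaussWeight _ _), lintegral_gaussWeight hv]

lemma lintegral_prod_gaussWeight {ι : Type*} [Fintype ι] {v : ι → ℝ} (hv : ∀ i, 0 < v i)
    (m : ι → ℝ) :
    ∫⁻ x : ι → ℝ, ∏ i, gaussWeight (v i) (m i) (x i) = ∏ i, gaussMass (v i) := by
  simpa using lintegral_prod_gaussWeight_mul hv m (G := fun _ => 1) measurable_const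

lemma one_add_mul_exp_neg_le {x : ℝ} (hx : 0 ≤ x) : (1 + x) * Real.exp (-x / 4) ≤ 5 := by
  have hexp := Real.add_one_le_exp (x / 4)
  calc (1 + x) * Real.exp (-x / 4) ≤ 5 * Real.exp (x / 4) * Real.exp (-x / 4) := by
        gcongr
        linarith
    _ = 5 := by rw [mul_assoc, ← Real.exp_add, neg_div, add_neg_cancel, Real.exp_zero, mul_one]

namespace Model

variable {I N : ℕ}

/-- The prior quadratic form of the factor effects. -/
noncomputable def effectEnergy (D : Model I N) (θ : State I) : ℝ :=
  ∑ k, ∑ i, D.τf k * θ.2 k i ^ 2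

/-- The residual of observation `n` once the factor effects `a` are subtracted. -/
def effectResidual (D : Model I N) (n : Fin N) (a : Fin 2 → Fin I → ℝ) : ℝ :=
  D.y n - a 0 (D.lev 0 n) - a 1 (D.lev 1 n)

lemma effectEnergy_nonneg (D : Model I N) (hf : ∀ k, 0 < D.τf k) (θ : State I) :
    0 ≤ D.effectEnergy θ :=
  Finset.sum_nonneg fun k _ => Finset.sum_nonneg fun _ _ => mul_nonneg (hf k).le (sq_nonneg _)

lemma measurable_effectEnergy (D : Model I N) : Measurable D.effectEnergy := by
  unfold effectEnergy
  fun_prop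

lemma prod_gaussWeight_half (D : Model I N) (θ : State I) :
    ∏ k, ∏ i, gaussWeight (D.τf k / 2) 0 (θ.2 k i) =
      ENNReal.ofReal (Real.exp (-D.effectEnergy θ / 4)) := by
  simp only [gaussWeight, ← ENNReal.ofReal_prod_of_nonneg fun _ _ => Real.exp_nonneg _,
    ← Real.exp_sum]
  rw [effectEnergy, neg_div, Finset.sum_div, ← Finset.sum_neg_distrib]
  congr 2
  refine Finset.sum_congr rfl fun k _ => ?_
  rw [Finset.sum_div, ← Finset.sum_neg_distrib]
  refine Finset.sum_congr rfl fun i _ => ?_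
  ring

lemma postWeight_pos (D : Model I N) (θ : State I) : 0 < D.postWeight θ :=
  mul_pos (Real.exp_pos _) (Finset.prod_pos fun _ _ => Real.exp_pos _)

lemma postWeight_le (D : Model I N) (hτ : 0 < D.τ) (ht : 0 ≤ D.tpr) (n : Fin N) (θ : State I) :
    D.postWeight θ ≤ Real.exp (-D.effectEnergy θ / 2) *
      Real.exp (-(D.τ * (θ.1 - D.effectResidual n θ.2) ^ 2) / 2) := by
  unfold postWeight
  gcongr
  · exact mul_nonneg ht (sq_nonneg _) |> le_add_of_nonneg_left
  rw [← Finset.mul_prod_erase _ _ (Finset.mem_univ n)]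
  refine (mul_le_of_le_one_right (Real.exp_nonneg _) ?_).trans_eq ?_
  · refine Finset.prod_le_one (fun _ _ => Real.exp_nonneg _) fun m _ => ?_
    rw [Real.exp_le_one_iff, neg_mul, neg_div, neg_nonpos]
    positivity
  · unfold effectResidual
    congr 1
    ring

/-- Only one observation is kept, which makes the bound integrable in `a⁽⁰⁾` even under the flat
prior. -/
lemma one_add_effectEnergy_mul_postWeight_le (D : Model I N) (hτ : 0 < D.τ)
    (hf : ∀ k, 0 < D.τf k) (ht : 0 ≤ D.tpr) (n : Fin N) (θ : State I) :
    ENNReal.ofReal ((1 + D.effectEnergy θ) * D.postWeight θ) ≤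
      ENNReal.ofReal 5 * (gaussWeight D.τ (D.effectResidual n θ.2) θ.1 *
        ∏ k, ∏ i, gaussWeight (D.τf k / 2) 0 (θ.2 k i)) := by
  have henergy := D.effectEnergy_nonneg hf θ
  rw [prod_gaussWeight_half, gaussWeight, ← ENNReal.ofReal_mul (Real.exp_nonneg _),
    ← ENNReal.ofReal_mul (by norm_num)]
  refine ENNReal.ofReal_le_ofReal ?_
  set E := D.effectEnergy θ
  set R := Real.exp (-(D.τ * (θ.1 - D.effectResidual n θ.2) ^ 2) / 2)
  have hhalf : Real.exp (-E / 2) = Real.exp (-E / 4) * Real.exp (-E / 4) := by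
    rw [← Real.exp_add]
    ring_nf
  calc (1 + E) * D.postWeight θ ≤ (1 + E) * (Real.exp (-E / 2) * R) := by
        gcongr
        exact D.postWeight_le hτ ht n θ
    _ = (1 + E) * Real.exp (-E / 4) * (R * Real.exp (-E / 4)) := by rw [hhalf]; ring
    _ ≤ 5 * (R * Real.exp (-E / 4)) := by
        gcongr
        exact one_add_mul_exp_neg_le henergy

lemma lintegral_one_add_effectEnergy_lt_top (D : Model I N) (hτ : 0 < D.τ)
    (hf : ∀ k, 0 < D.τf k) (ht : 0 ≤ D.tpr) (hN : 0 < N) :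
    ∫⁻ θ, ENNReal.ofReal ((1 + D.effectEnergy θ) * D.postWeight θ) < ∞ := by
  let n : Fin N := ⟨0, hN⟩
  have hres : Measurable (D.effectResidual n) := by
    unfold effectResidual
    fun_prop
  have hlevels (k : Fin 2) :
      Measurable fun x : Fin I → ℝ => ∏ i, gaussWeight (D.τf k / 2) 0 (x i) :=
    measurable_prod_apply fun _ => measurable_gaussWeight _ _
  refine (lintegral_mono fun θ =>
    D.one_add_effectEnergy_mul_postWeight_le hτ hf ht n θ).trans_lt ?_
  rw [lintegral_const_mul' _ _ ENNReal.ofReal_ne_top, Measure.volume_eq_prod,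
    lintegral_gaussWeight_mul_snd hτ hres
      (F := fun a => ∏ k, ∏ i, gaussWeight (D.τf k / 2) 0 (a k i)) (measurable_prod_apply hlevels),
    volume_pi, lintegral_fintype_prod_eq_prod hlevels]
  refine ENNReal.mul_lt_top ENNReal.ofReal_lt_top
    (ENNReal.mul_lt_top (gaussMass_lt_top _) (ENNReal.prod_lt_top fun k _ => ?_))
  rw [lintegral_prod_gaussWeight fun _ => half_pos (hf k)]
  exact ENNReal.prod_lt_top fun _ _ => gaussMass_lt_top _

/-- The measure with the unnormalized posterior density. -/
noncomputable def postMeasure (D : Model I N) : Measure (State I) :=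
  volume.withDensity fun θ => ENNReal.ofReal (D.postWeight θ)

lemma postMeasure_univ (D : Model I N) :
    D.postMeasure Set.univ = ∫⁻ θ, ENNReal.ofReal (D.postWeight θ) := by
  rw [postMeasure, withDensity_apply _ MeasurableSet.univ, Measure.restrict_univ]

lemma postMeasure_univ_ne_zero (D : Model I N) : D.postMeasure Set.univ ≠ 0 := by
  have hsupport : (Function.support fun θ => ENNReal.ofReal (D.postWeight θ)) = Set.univ :=
    Set.eq_univ_of_forall fun θ => (ENNReal.ofReal_pos.2 (D.postWeight_pos θ)).ne'
  rw [postMeasure_univ, ← pos_iff_ne_zero,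
    lintegral_pos_iff_support D.measurable_postWeight.ennreal_ofReal, hsupport]
  exact isOpen_univ.measure_pos volume Set.univ_nonempty

lemma postMeasure_univ_ne_top (D : Model I N) (hτ : 0 < D.τ) (hf : ∀ k, 0 < D.τf k)
    (ht : 0 ≤ D.tpr) (hN : 0 < N) : D.postMeasure Set.univ ≠ ∞ := by
  rw [postMeasure_univ]
  refine ((lintegral_mono fun θ => ENNReal.ofReal_le_ofReal ?_).trans_lt
    (D.lintegral_one_add_effectEnergy_lt_top hτ hf ht hN)).ne
  exact le_mul_of_one_le_left (D.postWeight_pos θ).le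
    (le_add_of_nonneg_right (D.effectEnergy_nonneg hf θ))

lemma posterior_eq_smul (D : Model I N) :
    D.posterior = (D.postMeasure Set.univ)⁻¹ • D.postMeasure := by
  rw [posterior, ProbabilityTheory.cond, Measure.restrict_univ]
  rfl

lemma isProbabilityMeasure_posterior (D : Model I N) (hτ : 0 < D.τ) (hf : ∀ k, 0 < D.τf k)
    (ht : 0 ≤ D.tpr) (hN : 0 < N) : IsProbabilityMeasure D.posterior := by
  constructor
  rw [posterior_eq_smul, Measure.smul_apply, smul_eq_mul]
  exact ENNReal.inv_mul_cancel D.postMeasure_univ_ne_zero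
    (D.postMeasure_univ_ne_top hτ hf ht hN)

lemma lintegral_posterior (D : Model I N) {F : State I → ℝ≥0∞} (hF : Measurable F) :
    ∫⁻ θ, F θ ∂D.posterior =
      (D.postMeasure Set.univ)⁻¹ * ∫⁻ θ, ENNReal.ofReal (D.postWeight θ) * F θ := by
  rw [posterior_eq_smul, lintegral_smul_measure, smul_eq_mul, postMeasure,
    lintegral_withDensity_eq_lintegral_mul _ D.measurable_postWeight.ennreal_ofReal hF]
  rfl

lemma lintegral_effectEnergy_posterior_lt_top (D : Model I N) (hτ : 0 < D.τ)
    (hf : ∀ k, 0 < D.τf k) (ht : 0 ≤ D.tpr) (hN : 0 < N) :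
    ∫⁻ θ, ENNReal.ofReal (D.effectEnergy θ) ∂D.posterior < ∞ := by
  rw [lintegral_posterior _ D.measurable_effectEnergy.ennreal_ofReal]
  refine ENNReal.mul_lt_top (ENNReal.inv_lt_top.2 (pos_iff_ne_zero.2 D.postMeasure_univ_ne_zero))
    ((lintegral_mono fun θ => ?_).trans_lt (D.lintegral_one_add_effectEnergy_lt_top hτ hf ht hN))
  have henergy := D.effectEnergy_nonneg hf θ
  rw [mul_comm, ← ENNReal.ofReal_mul henergy]
  exact ENNReal.ofReal_le_ofReal (mul_le_mul_of_nonneg_right (by linarith) (D.postWeight_pos θ).le)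

/-! ### Exactness of the block programs -/

/-- The law of the block drawn by the program of factor `k`, given the other factor. -/
noncomputable def drawKernel (D : Model I N) (k : Fin 2) :
    Kernel (Fin I → ℝ) (ℝ × (Fin I → ℝ)) :=
  (Kernel.id ×ₖ Kernel.const _ (noiseLaw I)).map fun p => D.blockDraw k p.1 p.2

lemma drawKernel_apply (D : Model I N) (k : Fin 2) (b : Fin I → ℝ) :
    D.drawKernel k b = (noiseLaw I).map (D.blockDraw k b) := by
  rw [drawKernel, Kernel.map_apply _ (D.measurable_blockDraw k), Kernel.prod_apply,
    Kernel.id_apply, Kernel.const_apply, Measure.dirac_prod,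
    Measure.map_map (D.measurable_blockDraw k) measurable_prodMk_left]
  rfl

instance (D : Model I N) (k : Fin 2) : IsMarkovKernel (D.drawKernel k) :=
  Kernel.IsMarkovKernel.map _ (D.measurable_blockDraw k)

lemma lintegral_posterior_toBlocks (D : Model I N) (hD : D.Nondegenerate) (k : Fin 2)
    {F : (Fin I → ℝ) × (ℝ × (Fin I → ℝ)) → ℝ≥0∞} (hF : Measurable F) :
    ∫⁻ θ, F (toBlocks k θ) ∂D.posterior = (D.postMeasure Set.univ)⁻¹ *
      ∫⁻ b, D.marginalWeight k b * ∫⁻ u, F (b, u) ∂(D.drawKernel k b) := by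
  let G (x : (Fin I → ℝ) × (ℝ × (Fin I → ℝ))) : ℝ≥0∞ :=
    ENNReal.ofReal (D.postWeight (assemble k x.2 x.1)) * F x
  have hG : Measurable G :=
    (D.measurable_postWeight.comp
      ((measurable_assemble k).comp measurable_swap)).ennreal_ofReal.mul hF
  have hcoord (θ : State I) :
      ENNReal.ofReal (D.postWeight θ) * F (toBlocks k θ) = G (toBlocks k θ) := by
    simp only [G, assemble_toBlocks]
  rw [D.lintegral_posterior (F := fun θ => F (toBlocks k θ)) (hF.comp (measurable_toBlocks k)),
    lintegral_congr hcoord, (measurePreserving_toBlocks k).lintegral_comp hG,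
    Measure.volume_eq_prod, lintegral_prod _ hG.aemeasurable]
  congr 1
  refine lintegral_congr fun b => ?_
  have hFb : Measurable fun u => F (b, u) := hF.comp measurable_prodMk_left
  rw [drawKernel_apply, lintegral_map hFb (D.measurable_blockDraw_left k b)]
  exact D.lintegral_postWeight_block hD k b hFb

lemma posterior_map_toBlocks (D : Model I N) (hD : D.Nondegenerate) (k : Fin 2) :
    D.posterior.map (toBlocks k) =
      D.posterior.map (fun θ : State I => θ.2 k.rev) ⊗ₘ D.drawKernel k := by
  refine Measure.ext_of_lintegral _ fun F hF => ?_
  have hmean : Measurable fun b => ∫⁻ u, F (b, u) ∂(D.drawKernel k b) :=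
    hF.lintegral_kernel_prod_right'
  have hblocks := D.lintegral_posterior_toBlocks hD k
    (F := fun x => ∫⁻ u, F (x.1, u) ∂(D.drawKernel k x.1)) (hmean.comp measurable_fst)
  simp only [lintegral_const, measure_univ, mul_one] at hblocks
  rw [lintegral_map hF (measurable_toBlocks k), Measure.lintegral_compProd hF,
    lintegral_map hmean (by fun_prop), D.lintegral_posterior_toBlocks hD k hF]
  exact hblocks.symm

lemma condDistrib_ae_eq_drawKernel (D : Model I N) (hD : D.Nondegenerate) (k : Fin 2) :
    condDistrib (fun θ : State I => (θ.1, θ.2 k)) (fun θ : State I => θ.2 k.rev) D.posterior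
      =ᵐ[D.posterior.map fun θ : State I => θ.2 k.rev] D.drawKernel k :=
  condDistrib_ae_eq_of_measure_eq_compProd _ (by fun_prop) (D.posterior_map_toBlocks hD k)

lemma blockKernel_apply (D : Model I N) (k : Fin 2) (θ : State I) :
    D.blockKernel k θ = (condDistrib (fun θ : State I => (θ.1, θ.2 k))
      (fun θ : State I => θ.2 k.rev) D.posterior (θ.2 k.rev)).map
        fun u => assemble k u (θ.2 k.rev) := by
  rw [blockKernel, Kernel.map_apply _ (measurable_assemble k), Kernel.comap_apply,
    Kernel.prod_apply, Kernel.id_apply, Measure.prod_dirac,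
    Measure.map_map (measurable_assemble k) (by fun_prop)]
  rfl

lemma blockKernel_ae_eq (D : Model I N) (hD : D.Nondegenerate) (k : Fin 2) :
    ∀ᵐ θ ∂D.posterior, D.blockKernel k θ =
      (noiseLaw I).map fun z => assemble k (D.blockDraw k (θ.2 k.rev) z) (θ.2 k.rev) := by
  have hother : Measurable fun θ : State I => θ.2 k.rev := by fun_prop
  filter_upwards [ae_of_ae_map hother.aemeasurable (D.condDistrib_ae_eq_drawKernel hD k)]
    with θ hθ
  rw [blockKernel_apply, hθ, drawKernel_apply, Measure.map_map (measurable_assemble_left k _)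
    (D.measurable_blockDraw_left k _)]
  rfl

lemma programExact (D : Model I N) (hD : D.Nondegenerate) : D.ProgramExact := by
  intro k
  filter_upwards [D.blockKernel_ae_eq hD k] with θ hθ
  simp only [hθ, val_blockProgram]

end Model

/-! ### Alternating projections -/

section Hilbert

open scoped InnerProductSpace

variable {𝕜 E : Type*} [RCLike 𝕜] [NormedAddCommGroup E] [InnerProductSpace 𝕜 E]

lemma norm_apply_sq_le_of_isSymmetric {S : E →ₗ[𝕜] E} (hS : S.IsSymmetric) (x : E) :
    ‖S x‖ ^ 2 ≤ ‖x‖ * ‖S (S x)‖ := by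
  rw [← inner_self_eq_norm_sq (𝕜 := 𝕜), hS]
  exact re_inner_le_norm _ _

lemma pow_mul_norm_le_of_isSymmetric {S : E →L[𝕜] E} (hS : (S : E →ₗ[𝕜] E).IsSymmetric) {q : ℝ}
    (hq : 0 < q) {x : E} (hx : q * ‖x‖ ≤ ‖S x‖) (t : ℕ) : q ^ t * ‖x‖ ≤ ‖(S ^ t) x‖ := by
  rcases (norm_nonneg x).eq_or_lt with hx0 | hx0
  · rw [← hx0, mul_zero]
    exact norm_nonneg _
  have hsucc : ∀ t, (S ^ (t + 1)) x = S ((S ^ t) x) := fun t => by rw [pow_succ']; rfl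
  have hgrowth : ∀ t, 0 < ‖(S ^ t) x‖ ∧ q * ‖(S ^ t) x‖ ≤ ‖(S ^ (t + 1)) x‖ := by
    intro t
    induction t with
    | zero => simpa using ⟨norm_pos_iff.1 hx0, hx⟩
    | succ t ih =>
      obtain ⟨hpos, hle⟩ := ih
      refine ⟨(mul_pos hq hpos).trans_le hle, le_of_mul_le_mul_left ?_ hpos⟩
      -- log-convexity of the norms of the iterates propagates the growth factor
      have hconvex := norm_apply_sq_le_of_isSymmetric hS ((S ^ t) x)
      simp only [ContinuousLinearMap.coe_coe, ← hsucc] at hconvex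
      nlinarith [mul_le_mul_of_nonneg_right hle (norm_nonneg ((S ^ (t + 1)) x))]
  induction t with
  | zero => simp
  | succ t ih =>
    calc q ^ (t + 1) * ‖x‖ = q * (q ^ t * ‖x‖) := by ring
      _ ≤ q * ‖(S ^ t) x‖ := by gcongr
      _ ≤ ‖(S ^ (t + 1)) x‖ := (hgrowth t).2

lemma opNorm_le_of_dense_decay {S : E →L[𝕜] E} (hS : (S : E →ₗ[𝕜] E).IsSymmetric) {κ : ℝ}
    (hκ : 0 < κ) {A : Set E} (hA : Dense A)
    (hdecay : ∀ x ∈ A, ∃ C : ℝ, ∀ t : ℕ, ‖(S ^ t) x‖ ≤ C * κ ^ t) : ‖S‖ ≤ κ := by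
  refine S.opNorm_le_bound hκ.le fun x => ?_
  have hclosed : IsClosed {x : E | ‖S x‖ ≤ κ * ‖x‖} := isClosed_le (by fun_prop) (by fun_prop)
  refine hclosed.closure_subset_iff.2 (fun x hx => ?_) (hA x)
  by_contra hlt
  simp only [Set.mem_ofPred_eq, not_le] at hlt
  obtain ⟨C, hC⟩ := hdecay x hx
  have hx0 : 0 < ‖x‖ := norm_pos_iff.2 <| by
    rintro rfl
    simp at hlt
  have hκq : κ < ‖S x‖ / ‖x‖ := (lt_div_iff₀ hx0).2 hlt
  have hgrowth := pow_mul_norm_le_of_isSymmetric hS (hκ.trans hκq)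
    (div_mul_cancel₀ ‖S x‖ hx0.ne').le
  obtain ⟨t, ht⟩ := pow_unbounded_of_one_lt (C / ‖x‖) ((one_lt_div hκ).2 hκq)
  rw [div_pow, div_lt_div_iff₀ hx0 (by positivity)] at ht
  exact ht.not_ge ((hgrowth t).trans (hC t))

lemma mul_eq_of_isSymmetric {e p : E →L[𝕜] E} (he : (e : E →ₗ[𝕜] E).IsSymmetric)
    (hp : (p : E →ₗ[𝕜] E).IsSymmetric) (hep : e * p = e) : p * e = e := by
  ext x
  refine ext_inner_right 𝕜 fun y => ?_
  calc ⟪p (e x), y⟫_𝕜 = ⟪x, (e * p) y⟫_𝕜 := (hp _ _).trans (he _ _)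
    _ = ⟪e x, y⟫_𝕜 := by rw [hep]; exact (he _ _).symm

/-- `p₀ p₁` is not symmetric, but `p₀ p₁ p₀ - e` is, and it has essentially the same powers. -/
lemma pow_succ_mul_mul_sub {R : Type*} [Ring R] {p₀ p₁ e : R} (hp₀ : IsIdempotentElem p₀)
    (he : IsIdempotentElem e) (he₀ : e * p₀ = e) (he₁ : e * p₁ = e) (h₀e : p₀ * e = e)
    (h₁e : p₁ * e = e) (t : ℕ) :
    (p₀ * p₁ * p₀ - e) ^ (t + 1) = (p₀ * p₁) ^ (t + 1) * p₀ - e := by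
  have hleft : e * (p₀ * p₁) = e := by rw [← mul_assoc, he₀, he₁]
  have hpow : ∀ t, e * (p₀ * p₁) ^ t = e := by
    intro t
    induction t with
    | zero => rw [pow_zero, mul_one]
    | succ t ih => rw [pow_succ', ← mul_assoc, hleft, ih]
  have hright : p₀ * p₁ * p₀ * e = e := by rw [mul_assoc, h₀e, mul_assoc, h₁e, h₀e]
  induction t with
  | zero => simp
  | succ t ih =>
    have habsorb : p₀ * p₁ * p₀ * ((p₀ * p₁) ^ (t + 1) * p₀) = (p₀ * p₁) ^ (t + 2) * p₀ := by
      have hidem : p₀ * (p₀ * p₁) ^ (t + 1) = (p₀ * p₁) ^ (t + 1) := by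
        rw [pow_succ', ← mul_assoc, ← mul_assoc, hp₀.eq]
      rw [mul_assoc (p₀ * p₁), ← mul_assoc p₀ _ p₀, hidem, ← mul_assoc, ← pow_succ']
    rw [pow_succ' _ (t + 1), ih, sub_mul, mul_sub, mul_sub, habsorb, hright, ← mul_assoc e, hpow,
      he₀, he.eq, sub_self, sub_zero]

lemma alternating_projections_decay {p₀ p₁ e : E →L[𝕜] E}
    (hs₀ : (p₀ : E →ₗ[𝕜] E).IsSymmetric) (hs₁ : (p₁ : E →ₗ[𝕜] E).IsSymmetric)
    (hse : (e : E →ₗ[𝕜] E).IsSymmetric) (hp₀ : IsIdempotentElem p₀) (he : IsIdempotentElem e)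
    (he₀ : e * p₀ = e) (he₁ : e * p₁ = e) {κ : ℝ} (hκ : 0 < κ) {A : Set E} (hA : Dense A)
    (hdecay : ∀ x ∈ A, ∃ C : ℝ, ∀ t : ℕ, ‖((p₀ * p₁) ^ t) (p₀ x) - e x‖ ≤ C * κ ^ t) (x : E) :
    ∃ C : ℝ, 0 ≤ C ∧ ∀ t : ℕ, ‖((p₀ * p₁) ^ t) x - e x‖ ≤ C * κ ^ t := by
  set S := p₀ * p₁ * p₀ - e
  have hpow : ∀ t, S ^ (t + 1) = (p₀ * p₁) ^ (t + 1) * p₀ - e :=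
    pow_succ_mul_mul_sub hp₀ he he₀ he₁ (mul_eq_of_isSymmetric hse hs₀ he₀)
      (mul_eq_of_isSymmetric hse hs₁ he₁)
  have hsymm : (S : E →ₗ[𝕜] E).IsSymmetric := by
    refine LinearMap.IsSymmetric.sub (fun x y => ?_) hse
    exact (hs₀ _ _).trans ((hs₁ _ _).trans (hs₀ _ _))
  have hnorm : ‖S‖ ≤ κ := by
    refine opNorm_le_of_dense_decay hsymm hκ hA fun x hx => ?_
    obtain ⟨C, hC⟩ := hdecay x hx
    refine ⟨max C ‖x‖, fun t => ?_⟩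
    rcases t with _ | t
    · simp
    · rw [hpow]
      exact (hC (t + 1)).trans (by gcongr; exact le_max_left _ _)
  have hshift : ∀ t, ((p₀ * p₁) ^ (t + 2)) x - e x = (S ^ (t + 1)) (p₁ x) := fun t => by
    rw [hpow, pow_succ, ← mul_assoc, sub_apply, ← mul_apply_eq_comp e, he₁]
    rfl
  refine ⟨‖x - e x‖ + ‖p₀ (p₁ x) - e x‖ / κ + ‖p₁ x‖ / κ, by positivity, fun t => ?_⟩
  rw [add_mul, add_mul]
  rcases t with _ | _ | t
  · refine le_add_of_le_of_nonneg (le_add_of_le_of_nonneg ?_ (by positivity)) (by positivity)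
    simp
  · refine le_add_of_le_of_nonneg (le_add_of_nonneg_of_le (by positivity) ?_) (by positivity)
    rw [zero_add, pow_one, pow_one, div_mul_cancel₀ _ hκ.ne']
    rfl
  · refine le_add_of_nonneg_of_le (by positivity) ?_
    rw [hshift]
    calc ‖(S ^ (t + 1)) (p₁ x)‖ ≤ ‖S‖ ^ (t + 1) * ‖p₁ x‖ :=
          (S ^ (t + 1)).le_of_opNorm_le (norm_pow_le' S t.succ_pos) _
      _ ≤ κ ^ (t + 1) * ‖p₁ x‖ := by gcongr
      _ = ‖p₁ x‖ / κ * κ ^ (t + 2) := by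
        rw [pow_succ κ (t + 1)]
        field_simp

end Hilbert

/-! ### Contraction of the block draws -/

lemma sum_sq_sub_mul_sum_le {ι : Type*} [Fintype ι] (δ : ι → ℝ) {r : ℝ} (hr : 0 ≤ r)
    (hcard : r * Fintype.card ι ≤ 2) : ∑ i, (δ i - r * ∑ j, δ j) ^ 2 ≤ ∑ i, δ i ^ 2 := by
  set s := ∑ j, δ j with hs
  have hexpand : ∑ i, (δ i - r * s) ^ 2 =
      ∑ i, δ i ^ 2 - r * s ^ 2 * (2 - r * Fintype.card ι) := by
    calc ∑ i, (δ i - r * s) ^ 2 = ∑ i, (δ i ^ 2 - 2 * (r * s) * δ i + (r * s) ^ 2) :=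
          Finset.sum_congr rfl fun i _ => by ring
      _ = ∑ i, δ i ^ 2 - 2 * (r * s) * s + Fintype.card ι * (r * s) ^ 2 := by
        rw [Finset.sum_add_distrib, Finset.sum_sub_distrib, ← Finset.mul_sum, ← hs,
          Finset.sum_const, Finset.card_univ, nsmul_eq_mul]
      _ = _ := by ring
  rw [hexpand]
  exact sub_le_self _ (mul_nonneg (by positivity) (sub_nonneg.2 hcard))

namespace Model

variable {I N : ℕ}

lemma resSum_sub_resSum (D : Model I N) (k : Fin 2) (b b' : Fin I → ℝ) (i : Fin I) :
    D.resSum k b i - D.resSum k b' i =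
      -∑ n with D.lev k n = i, (b (D.lev k.rev n) - b' (D.lev k.rev n)) := by
  rw [resSum, resSum, ← Finset.sum_sub_distrib, Finset.sum_filter, ← Finset.sum_neg_distrib]
  refine Finset.sum_congr rfl fun n _ => ?_
  split_ifs <;> ring

lemma sum_comp_lev (D : Model I N) {c : ℕ} {k : Fin 2} (hocc : ∀ i, D.occ k i = c)
    (f : Fin I → ℝ) : ∑ n, f (D.lev k n) = c * ∑ j, f j := by
  rw [D.sum_eq_sum_levels k fun _ i => f i, Finset.mul_sum]
  refine Finset.sum_congr rfl fun i _ => ?_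
  rw [← hocc i, occ, ← Finset.sum_filter, Finset.sum_const, nsmul_eq_mul]

lemma sum_sum_filter_lev (D : Model I N) {c : ℕ} {k : Fin 2} (hocc : ∀ i, D.occ k.rev i = c)
    (f : Fin I → ℝ) : ∑ i, ∑ n with D.lev k n = i, f (D.lev k.rev n) = c * ∑ j, f j := by
  rw [← D.sum_comp_lev hocc f, D.sum_eq_sum_levels k fun n _ => f (D.lev k.rev n)]
  simp only [Finset.sum_filter]

/-- The contraction factor of the update of the effects of factor `k` if all levels have `c`
observations. -/
noncomputable def blockRate (D : Model I N) (c : ℕ) (k : Fin 2) : ℝ :=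
  D.τ * c / (D.τf k + D.τ * c)

/-- The sensitivity of the conditional mean of `a⁽⁰⁾` to the sum of the effects of factor `k.rev`
if all levels have `c` observations. -/
noncomputable def globalRate (D : Model I N) (c : ℕ) (k : Fin 2) : ℝ :=
  D.τ * D.τf k / (D.τf k + D.τ * c) * c / D.globalPrec k

section Balanced

variable (D : Model I N) {c : ℕ} {k : Fin 2}

lemma globalPrec_eq (hocc : ∀ i, D.occ k i = c) :
    D.globalPrec k = D.tpr + I * (D.τ * D.τf k / (D.τf k + D.τ * c) * c) := by
  simp only [globalPrec, levelWeight, levelPrec, hocc, Finset.sum_const, Finset.card_univ,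
    Fintype.card_fin, nsmul_eq_mul]

lemma globalRate_bounds (hτ : 0 ≤ D.τ) (hf : 0 ≤ D.τf k) (ht : 0 ≤ D.tpr)
    (hocc : ∀ i, D.occ k i = c) : 0 ≤ D.globalRate c k ∧ D.globalRate c k * I ≤ 1 := by
  rw [globalRate, D.globalPrec_eq hocc]
  set w := D.τ * D.τf k / (D.τf k + D.τ * c) * c
  have hw : 0 ≤ w := by positivity
  have hprec : 0 ≤ D.tpr + I * w := add_nonneg ht (mul_nonneg (Nat.cast_nonneg I) hw)
  refine ⟨div_nonneg hw hprec, ?_⟩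
  rw [div_mul_eq_mul_div, mul_comm w]
  exact div_le_one_of_le₀ (le_add_of_nonneg_left ht) hprec

lemma globalMean_sub_globalMean (hocc : ∀ k i, D.occ k i = c) (b b' : Fin I → ℝ) :
    D.globalMean k b - D.globalMean k b' = -(D.globalRate c k * ∑ j, (b j - b' j)) := by
  rw [globalMean, globalMean, ← sub_div, add_sub_add_left_eq_sub, ← Finset.sum_sub_distrib]
  simp only [levelWeight, levelPrec, hocc, ← mul_sub, resSum_sub_resSum, ← Finset.mul_sum,
    Finset.sum_neg_distrib]
  rw [D.sum_sum_filter_lev (hocc _) fun j => b j - b' j, globalRate]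
  ring

lemma blockDraw_fst_sub (hocc : ∀ k i, D.occ k i = c) (b b' : Fin I → ℝ) (z : Noise I) :
    (D.blockDraw k b z).1 - (D.blockDraw k b' z).1 =
      -(D.globalRate c k * ∑ j, (b j - b' j)) := by
  rw [← D.globalMean_sub_globalMean hocc]
  simp only [blockDraw, add_sub_add_right_eq_sub]

lemma blockDraw_snd_sub (hocc : ∀ k i, D.occ k i = c) (b b' : Fin I → ℝ) (z : Noise I)
    (i : Fin I) :
    (D.blockDraw k b z).2 i - (D.blockDraw k b' z).2 i =
      -(D.τ / (D.τf k + D.τ * c) * ∑ n with D.lev k n = i, (b (D.lev k.rev n) -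
        b' (D.lev k.rev n) - D.globalRate c k * ∑ j, (b j - b' j))) := by
  have hmean : (D.blockDraw k b z).2 i - (D.blockDraw k b' z).2 i =
      D.τ / (D.τf k + D.τ * c) * ((D.resSum k b i - D.resSum k b' i) -
        c * ((D.blockDraw k b z).1 - (D.blockDraw k b' z).1)) := by
    simp only [blockDraw, levelMean, levelPrec, hocc]
    ring
  rw [hmean, D.blockDraw_fst_sub hocc, resSum_sub_resSum,
    Finset.sum_sub_distrib (f := fun n => b (D.lev k.rev n) - b' (D.lev k.rev n)),
    Finset.sum_const, nsmul_eq_mul, ← occ, hocc]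
  ring

lemma blockDraw_fst_sub_sq_le (hτ : 0 ≤ D.τ) (hf : 0 ≤ D.τf k) (ht : 0 ≤ D.tpr)
    (hocc : ∀ k i, D.occ k i = c) (b b' : Fin I → ℝ) (z : Noise I) :
    ((D.blockDraw k b z).1 - (D.blockDraw k b' z).1) ^ 2 ≤ ∑ j, (b j - b' j) ^ 2 := by
  obtain ⟨hr, hrI⟩ := D.globalRate_bounds hτ hf ht (hocc k)
  set r := D.globalRate c k
  have hI : (I : ℝ) ≤ I ^ 2 := by exact_mod_cast Nat.le_self_pow two_ne_zero I
  have hsum : (∑ j, (b j - b' j)) ^ 2 ≤ I * ∑ j, (b j - b' j) ^ 2 := by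
    simpa only [Finset.card_univ, Fintype.card_fin] using sq_sum_le_card_mul_sum_sq
      (s := (Finset.univ : Finset (Fin I))) (f := fun j => b j - b' j)
  rw [D.blockDraw_fst_sub hocc]
  calc (-(r * ∑ j, (b j - b' j))) ^ 2 = r ^ 2 * (∑ j, (b j - b' j)) ^ 2 := by ring
    _ ≤ r ^ 2 * (I ^ 2 * ∑ j, (b j - b' j) ^ 2) := by
      gcongr
      exact hsum.trans (by gcongr)
    _ = (r * I) ^ 2 * ∑ j, (b j - b' j) ^ 2 := by ring
    _ ≤ ∑ j, (b j - b' j) ^ 2 :=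
      mul_le_of_le_one_left (by positivity) (pow_le_one₀ (by positivity) hrI)

lemma sum_blockDraw_snd_sub_sq_le (hτ : 0 ≤ D.τ) (hf : 0 ≤ D.τf k) (ht : 0 ≤ D.tpr)
    (hocc : ∀ k i, D.occ k i = c) (b b' : Fin I → ℝ) (z : Noise I) :
    ∑ i, ((D.blockDraw k b z).2 i - (D.blockDraw k b' z).2 i) ^ 2 ≤
      D.blockRate c k ^ 2 * ∑ j, (b j - b' j) ^ 2 := by
  obtain ⟨hr, hrI⟩ := D.globalRate_bounds hτ hf ht (hocc k)
  set q := D.τ / (D.τf k + D.τ * c) with hq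
  set x : Fin I → ℝ := fun j => b j - b' j - D.globalRate c k * ∑ j, (b j - b' j)
  have hcauchy : ∀ i, (∑ n with D.lev k n = i, x (D.lev k.rev n)) ^ 2 ≤
      c * ∑ n with D.lev k n = i, x (D.lev k.rev n) ^ 2 := fun i => by
    rw [← hocc k i]
    exact sq_sum_le_card_mul_sum_sq
  have hcentered : ∑ j, x j ^ 2 ≤ ∑ j, (b j - b' j) ^ 2 :=
    sum_sq_sub_mul_sum_le (fun j => b j - b' j) hr (by rw [Fintype.card_fin]; linarith)
  calc ∑ i, ((D.blockDraw k b z).2 i - (D.blockDraw k b' z).2 i) ^ 2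
      = q ^ 2 * ∑ i, (∑ n with D.lev k n = i, x (D.lev k.rev n)) ^ 2 := by
        rw [Finset.mul_sum]
        refine Finset.sum_congr rfl fun i _ => ?_
        rw [D.blockDraw_snd_sub hocc, neg_sq, mul_pow]
    _ ≤ q ^ 2 * ∑ i, c * ∑ n with D.lev k n = i, x (D.lev k.rev n) ^ 2 := by
        gcongr with i
        exact hcauchy i
    _ = q ^ 2 * (c * (c * ∑ j, x j ^ 2)) := by
        rw [← Finset.mul_sum, D.sum_sum_filter_lev (hocc _) fun j => x j ^ 2]
    _ ≤ q ^ 2 * (c * (c * ∑ j, (b j - b' j) ^ 2)) := by gcongr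
    _ = D.blockRate c k ^ 2 * ∑ j, (b j - b' j) ^ 2 := by
        rw [blockRate, hq]
        ring

end Balanced

end Model

/-! ### Conditional expectations as projections -/

section Projection

variable {X : Type*} {m₁ m₂ m m₀ : MeasurableSpace X} {μ : Measure X}

/-- Conditional expectation as an operator from `L²` to itself. -/
noncomputable def l2Proj (μ : Measure X) (hm : m ≤ m₀) : Lp ℝ 2 μ →L[ℝ] Lp ℝ 2 μ :=
  (lpMeas ℝ ℝ m 2 μ).subtypeL ∘L condExpL2 ℝ ℝ hm

lemma isSymmetric_l2Proj (hm : m ≤ m₀) : (l2Proj μ hm : Lp ℝ 2 μ →ₗ[ℝ] Lp ℝ 2 μ).IsSymmetric :=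
  fun _ _ => inner_condExpL2_left_eq_right hm

lemma l2Proj_ae_eq_condExp [IsFiniteMeasure μ] (hm : m ≤ m₀) (F : Lp ℝ 2 μ) :
    l2Proj μ hm F =ᵐ[μ] μ[F | m] := by
  have hF := (Lp.memLp F).condExpL2_ae_eq_condExp (𝕜 := ℝ) hm
  rwa [Lp.toLp_coeFn] at hF

lemma l2Proj_mul_of_le [IsFiniteMeasure μ] (h₁₂ : m₁ ≤ m₂) (hm₂ : m₂ ≤ m₀) :
    l2Proj μ (h₁₂.trans hm₂) * l2Proj μ hm₂ = l2Proj μ (h₁₂.trans hm₂) := by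
  ext1 F
  exact Lp.ext <| (l2Proj_ae_eq_condExp _ _).trans <|
    ((condExp_congr_ae (l2Proj_ae_eq_condExp hm₂ F)).trans (condExp_condExp_of_le h₁₂ hm₂)).trans
      (l2Proj_ae_eq_condExp _ _).symm

lemma isIdempotentElem_l2Proj [IsFiniteMeasure μ] (hm : m ≤ m₀) : IsIdempotentElem (l2Proj μ hm) :=
  l2Proj_mul_of_le le_rfl hm

lemma l2Proj_bot_ae_eq [IsProbabilityMeasure μ] (F : Lp ℝ 2 μ) :
    l2Proj μ (bot_le : ⊥ ≤ m₀) F =ᵐ[μ] fun _ => ∫ x, F x ∂μ :=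
  (l2Proj_ae_eq_condExp _ F).trans (by rw [condExp_bot])

variable {E : Type*} [NormedAddCommGroup E] {φ : X → E} {h : X → ℝ} {K : ℝ}

lemma abs_sub_integral_le [IsProbabilityMeasure μ] (hφ : Integrable φ μ) (hh : Integrable h μ)
    (hK : 0 ≤ K) (hlip : ∀ x y, |h x - h y| ≤ K * dist (φ x) (φ y)) (x : X) :
    |h x - ∫ y, h y ∂μ| ≤ K * (‖φ x‖ + ∫ y, ‖φ y‖ ∂μ) := by
  calc |h x - ∫ y, h y ∂μ| = ‖∫ y, (h x - h y) ∂μ‖ := by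
        rw [integral_sub (integrable_const _) hh, integral_const, probReal_univ, one_smul,
          Real.norm_eq_abs]
    _ ≤ ∫ y, K * (‖φ x‖ + ‖φ y‖) ∂μ := by
        refine norm_integral_le_of_norm_le (((integrable_const _).add hφ.norm).const_mul K)
          (Filter.Eventually.of_forall fun y => (hlip x y).trans ?_)
        gcongr
        exact dist_le_norm_add_norm _ _
    _ = K * (‖φ x‖ + ∫ y, ‖φ y‖ ∂μ) := by
        rw [integral_const_mul, integral_add (integrable_const _) hφ.norm, integral_const,
          probReal_univ, one_smul]

lemma norm_sub_l2Proj_bot_le [IsProbabilityMeasure μ] (hφ : MemLp φ 2 μ) {F : Lp ℝ 2 μ}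
    (hFh : F =ᵐ[μ] h) (hK : 0 ≤ K) (hlip : ∀ x y, |h x - h y| ≤ K * dist (φ x) (φ y)) :
    ‖F - l2Proj μ bot_le F‖ ≤
      K * ‖(hφ.norm.add (memLp_const (∫ y, ‖φ y‖ ∂μ))).toLp _‖ := by
  have hh : Integrable h μ := ((Lp.memLp F).integrable one_le_two).congr hFh
  set W := hφ.norm.add (memLp_const (∫ y, ‖φ y‖ ∂μ))
  refine Lp.norm_le_mul_norm_of_ae_le_mul ?_
  filter_upwards [Lp.coeFn_sub F (l2Proj μ bot_le F), hFh, l2Proj_bot_ae_eq F, W.coeFn_toLp]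
    with x hsub hF hmean hW
  have hnonneg : 0 ≤ ‖φ x‖ + ∫ y, ‖φ y‖ ∂μ :=
    add_nonneg (norm_nonneg _) (integral_nonneg fun _ => norm_nonneg _)
  rw [hsub, Pi.sub_apply, hF, hmean, integral_congr_ae hFh, hW, Real.norm_eq_abs, Pi.add_apply,
    Real.norm_of_nonneg hnonneg]
  exact abs_sub_integral_le (hφ.integrable one_le_two) hh hK hlip x

end Projection

namespace Model

variable {I N : ℕ}

/-! ### The transition operator of the sampler on `L²` -/

/-- The information kept by the block update of factor `k`: the effects of the other factor. -/
abbrev keptSigma (I : ℕ) (k : Fin 2) : MeasurableSpace (State I) :=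
  MeasurableSpace.comap (fun θ : State I => θ.2 k.rev) MeasurableSpace.pi

lemma measurable_kept (k : Fin 2) : Measurable fun θ : State I => θ.2 k.rev := by fun_prop

lemma keptSigma_le (k : Fin 2) : keptSigma I k ≤ Prod.instMeasurableSpace :=
  (measurable_kept k).comap_le

instance (D : Model I N) (k : Fin 2) : IsMarkovKernel (D.blockKernel k) := by
  unfold blockKernel
  exact Kernel.IsMarkovKernel.map _ (measurable_assemble k)

instance (D : Model I N) : IsMarkovKernel D.gibbsKernel := by
  unfold gibbsKernel
  infer_instance

lemma blockKernel_comp_posterior (D : Model I N) (k : Fin 2) :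
    D.blockKernel k ∘ₘ D.posterior = D.posterior := by
  refine Measure.ext_of_lintegral _ fun F hF => ?_
  have hFa : Measurable fun x : (Fin I → ℝ) × (ℝ × (Fin I → ℝ)) => F (assemble k x.2 x.1) :=
    hF.comp ((measurable_assemble k).comp measurable_swap)
  have hcond (θ : State I) : ∫⁻ y, F y ∂(D.blockKernel k θ) =
      (fun b => ∫⁻ u, F (assemble k u b) ∂(condDistrib (fun θ : State I => (θ.1, θ.2 k))
        (fun θ : State I => θ.2 k.rev) D.posterior b)) (θ.2 k.rev) := by
    rw [blockKernel_apply, lintegral_map hF (measurable_assemble_left k _)]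
  rw [Measure.lintegral_bind (D.blockKernel k).aemeasurable hF.aemeasurable,
    lintegral_congr hcond, ← lintegral_map (hFa.lintegral_kernel_prod_right') (measurable_kept k),
    ← Measure.lintegral_compProd hFa, compProd_map_condDistrib (by fun_prop),
    lintegral_map hFa (by fun_prop)]
  exact lintegral_congr fun θ => congrArg F (assemble_toBlocks k θ)

lemma gibbsKernel_comp_posterior (D : Model I N) :
    D.gibbsKernel ∘ₘ D.posterior = D.posterior := by
  rw [gibbsKernel, ← Measure.comp_assoc, blockKernel_comp_posterior, blockKernel_comp_posterior]

lemma condExp_keptSigma_ae_eq (D : Model I N) [IsFiniteMeasure D.posterior] (k : Fin 2)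
    {f : State I → ℝ} (hf : StronglyMeasurable f) (hfi : Integrable f D.posterior) :
    D.posterior[f | keptSigma I k] =ᵐ[D.posterior] fun θ => ∫ y, f y ∂(D.blockKernel k θ) := by
  have hfa : StronglyMeasurable fun x : (Fin I → ℝ) × (ℝ × (Fin I → ℝ)) =>
      f (assemble k x.2 x.1) :=
    hf.comp_measurable ((measurable_assemble k).comp measurable_swap)
  have hself (θ : State I) : f (assemble k (θ.1, θ.2 k) (θ.2 k.rev)) = f θ :=
    congrArg f (assemble_toBlocks k θ)
  have hcond := condExp_prod_ae_eq_integral_condDistrib (μ := D.posterior)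
    (X := fun θ : State I => θ.2 k.rev) (Y := fun θ : State I => (θ.1, θ.2 k))
    (measurable_kept k) (by fun_prop) hfa (by simpa only [hself] using hfi)
  simp only [hself] at hcond
  filter_upwards [hcond] with θ hθ
  rw [hθ, blockKernel_apply,
    integral_map (measurable_assemble_left k _).aemeasurable hf.aestronglyMeasurable]

lemma integral_blockKernel_ae_eq (D : Model I N) [IsFiniteMeasure D.posterior] (k : Fin 2)
    (F : Lp ℝ 2 D.posterior) {g : State I → ℝ} (hg : g =ᵐ[D.posterior] F) :
    (fun θ => ∫ y, g y ∂(D.blockKernel k θ)) =ᵐ[D.posterior]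
      l2Proj D.posterior (keptSigma_le k) F := by
  have hblock : ∀ᵐ θ ∂D.posterior, g =ᵐ[D.blockKernel k θ] F := by
    apply Measure.ae_ae_of_ae_comp
    rwa [blockKernel_comp_posterior]
  filter_upwards [hblock, l2Proj_ae_eq_condExp (keptSigma_le k) F, D.condExp_keptSigma_ae_eq k
    (Lp.stronglyMeasurable F) ((Lp.memLp F).integrable one_le_two)] with θ hgF hproj hcond
  rw [integral_congr_ae hgF, hproj, hcond]

/-- The operator of one iteration of the sampler. -/
noncomputable def gibbsOp (D : Model I N) : Lp ℝ 2 D.posterior →L[ℝ] Lp ℝ 2 D.posterior :=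
  l2Proj D.posterior (keptSigma_le 0) * l2Proj D.posterior (keptSigma_le 1)

lemma integral_gibbsKernel_ae_eq (D : Model I N) [IsFiniteMeasure D.posterior]
    (F : Lp ℝ 2 D.posterior) {g : State I → ℝ} (hg : g =ᵐ[D.posterior] F) :
    (fun θ => ∫ y, g y ∂(D.gibbsKernel θ)) =ᵐ[D.posterior] D.gibbsOp F := by
  have hgi : Integrable g (D.gibbsKernel ∘ₘ D.posterior) := by
    rw [gibbsKernel_comp_posterior]
    exact ((Lp.memLp F).integrable one_le_two).congr hg.symm
  filter_upwards [D.integral_blockKernel_ae_eq 0 _ (D.integral_blockKernel_ae_eq 1 F hg),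
    Measure.ae_integrable_of_integrable_comp hgi] with θ hblocks hint
  exact (Kernel.integral_comp hint).trans hblocks

lemma kernelIter_gibbsKernel_ae_eq (D : Model I N) [IsFiniteMeasure D.posterior]
    {f : State I → ℝ} (hf : MemLp f 2 D.posterior) (t : ℕ) :
    kernelIter D.gibbsKernel f t =ᵐ[D.posterior] (D.gibbsOp ^ t) (hf.toLp f) := by
  induction t with
  | zero => exact hf.coeFn_toLp.symm
  | succ t ih =>
    rw [pow_succ', kernelIter, Function.iterate_succ_apply']
    exact D.integral_gibbsKernel_ae_eq _ ih

/-! ### Smoothing by the block updates -/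

/-- The state after the update of the block `(a⁽⁰⁾, a⁽ᵏ⁾)` from `θ` with noise `z`. -/
noncomputable def blockUpdate (D : Model I N) (k : Fin 2) (θ : State I) (z : Noise I) : State I :=
  assemble k (D.blockDraw k (θ.2 k.rev) z) (θ.2 k.rev)

/-- The mean of `g` after the update of the block `(a⁽⁰⁾, a⁽ᵏ⁾)`. -/
noncomputable def blockAverage (D : Model I N) (k : Fin 2) (g : State I → ℝ) (θ : State I) : ℝ :=
  ∫ z, g (D.blockUpdate k θ z) ∂(noiseLaw I)

/-- The effects of factor `k` as a vector with the Euclidean norm, for which the block updates are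
contractions. -/
def effects (k : Fin 2) (θ : State I) : EuclideanSpace ℝ (Fin I) := WithLp.toLp 2 (θ.2 k)

lemma dist_effects (k : Fin 2) (θ θ' : State I) :
    dist (effects k θ) (effects k θ') = √(∑ i, (θ.2 k i - θ'.2 k i) ^ 2) := by
  simp only [EuclideanSpace.dist_eq, effects, Real.dist_eq, sq_abs]

section Average

variable (D : Model I N) (k : Fin 2)

lemma measurable_uncurry_blockUpdate : Measurable (Function.uncurry (D.blockUpdate k)) := by
  have hkept : Measurable fun p : State I × Noise I => p.1.2 k.rev :=
    (measurable_kept k).comp measurable_fst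
  exact (measurable_assemble k).comp
    (((D.measurable_blockDraw k).comp (hkept.prodMk measurable_snd)).prodMk hkept)

lemma measurable_blockUpdate (θ : State I) : Measurable (D.blockUpdate k θ) :=
  (measurable_assemble_left k _).comp (D.measurable_blockDraw_left k _)

variable {g : State I → ℝ}

lemma measurable_blockAverage (hg : Measurable g) : Measurable (D.blockAverage k g) := by
  have hcomp : StronglyMeasurable fun p : State I × Noise I => g (D.blockUpdate k p.1 p.2) :=
    (hg.comp (D.measurable_uncurry_blockUpdate k)).stronglyMeasurable
  exact (hcomp.integral_prod_right' (ν := noiseLaw I)).measurable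

lemma abs_blockAverage_le {B : ℝ} (hB : ∀ θ, |g θ| ≤ B) (θ : State I) :
    |D.blockAverage k g θ| ≤ B := by
  simpa only [blockAverage, probReal_univ, mul_one, Real.norm_eq_abs] using
    norm_integral_le_of_norm_le_const (μ := noiseLaw I) (C := B)
      (f := fun z => g (D.blockUpdate k θ z)) (Filter.Eventually.of_forall fun _ => hB _)

lemma integrable_comp_blockUpdate (hg : Measurable g) {B : ℝ} (hB : ∀ θ, |g θ| ≤ B)
    (θ : State I) : Integrable (fun z => g (D.blockUpdate k θ z)) (noiseLaw I) :=
  Integrable.of_bound (hg.comp (D.measurable_blockUpdate k θ)).aestronglyMeasurable B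
    (Filter.Eventually.of_forall fun _ => hB _)

lemma abs_blockAverage_sub_le (hg : Measurable g) {B : ℝ} (hB : ∀ θ, |g θ| ≤ B) {K : ℝ}
    {θ θ' : State I}
    (hK : ∀ z, |g (D.blockUpdate k θ z) - g (D.blockUpdate k θ' z)| ≤ K) :
    |D.blockAverage k g θ - D.blockAverage k g θ'| ≤ K := by
  rw [blockAverage, blockAverage, ← integral_sub (D.integrable_comp_blockUpdate k hg hB θ)
    (D.integrable_comp_blockUpdate k hg hB θ')]
  simpa only [probReal_univ, mul_one, Real.norm_eq_abs] using
    norm_integral_le_of_norm_le_const (μ := noiseLaw I) (C := K)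
      (f := fun z => g (D.blockUpdate k θ z) - g (D.blockUpdate k θ' z))
      (Filter.Eventually.of_forall hK)

lemma l2Proj_ae_eq_blockAverage (hD : D.Nondegenerate) [IsFiniteMeasure D.posterior]
    (hg : Measurable g) {F : Lp ℝ 2 D.posterior} (hFg : F =ᵐ[D.posterior] g) :
    l2Proj D.posterior (keptSigma_le k) F =ᵐ[D.posterior] D.blockAverage k g := by
  filter_upwards [D.integral_blockKernel_ae_eq k F hFg.symm, D.blockKernel_ae_eq hD k]
    with θ hproj hkernel
  rw [← hproj, hkernel]
  exact integral_map (D.measurable_blockUpdate k θ).aemeasurable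
    hg.stronglyMeasurable.aestronglyMeasurable

end Average

lemma blockRate_nonneg (D : Model I N) {k : Fin 2} (hτ : 0 ≤ D.τ) (hf : 0 ≤ D.τf k) (c : ℕ) :
    0 ≤ D.blockRate c k := by
  unfold blockRate
  positivity

lemma blockRate_le_one (D : Model I N) {k : Fin 2} (hτ : 0 ≤ D.τ) (hf : 0 ≤ D.τf k) (c : ℕ) :
    D.blockRate c k ≤ 1 :=
  div_le_one_of_le₀ (le_add_of_nonneg_left hf) (by positivity)

section Contraction

variable (D : Model I N) {c : ℕ} {k : Fin 2} (hτ : 0 ≤ D.τ) (hf : 0 ≤ D.τf k) (ht : 0 ≤ D.tpr)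
  (hocc : ∀ k i, D.occ k i = c)

include hτ hf ht hocc

lemma dist_effects_blockUpdate_le (θ θ' : State I) (z : Noise I) :
    dist (effects k (D.blockUpdate k θ z)) (effects k (D.blockUpdate k θ' z)) ≤
      D.blockRate c k * dist (effects k.rev θ) (effects k.rev θ') := by
  rw [dist_effects, dist_effects, ← Real.sqrt_sq (D.blockRate_nonneg hτ hf c),
    ← Real.sqrt_mul (sq_nonneg _)]
  refine Real.sqrt_le_sqrt ?_
  simpa only [blockUpdate, assemble, if_true] using
    D.sum_blockDraw_snd_sub_sq_le hτ hf ht hocc (θ.2 k.rev) (θ'.2 k.rev) z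

lemma dist_blockUpdate_le (θ θ' : State I) (z : Noise I) :
    dist (D.blockUpdate k θ z) (D.blockUpdate k θ' z) ≤
      dist (effects k.rev θ) (effects k.rev θ') := by
  have hcoord (l : Fin 2) (η η' : State I) (i : Fin I) :
      dist (η.2 l i) (η'.2 l i) ≤ dist (effects l η) (effects l η') :=
    PiLp.dist_apply_le (effects l η) (effects l η') i
  have hdrawn : dist (effects k (D.blockUpdate k θ z)) (effects k (D.blockUpdate k θ' z)) ≤
      dist (effects k.rev θ) (effects k.rev θ') :=
    (D.dist_effects_blockUpdate_le hτ hf ht hocc θ θ' z).trans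
      (mul_le_of_le_one_left dist_nonneg (D.blockRate_le_one hτ hf c))
  rw [Prod.dist_eq, max_le_iff, dist_pi_le_iff dist_nonneg]
  refine ⟨?_, fun l => (dist_pi_le_iff dist_nonneg).2 fun i => ?_⟩
  · rw [Real.dist_eq, dist_effects]
    exact Real.abs_le_sqrt (D.blockDraw_fst_sub_sq_le hτ hf ht hocc (θ.2 k.rev) (θ'.2 k.rev) z)
  · by_cases hl : l = k
    · subst hl
      exact (hcoord _ _ _ i).trans hdrawn
    · simpa only [blockUpdate, assemble, hl, if_false] using hcoord k.rev θ θ' i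

variable {g : State I → ℝ} (hg : Measurable g) {B : ℝ} (hB : ∀ θ, |g θ| ≤ B)

include hg hB

lemma abs_blockAverage_sub_le_of_lipschitz_effects {K : ℝ} (hK : 0 ≤ K)
    (hgK : ∀ θ θ', |g θ - g θ'| ≤ K * dist (effects k θ) (effects k θ')) (θ θ' : State I) :
    |D.blockAverage k g θ - D.blockAverage k g θ'| ≤
      D.blockRate c k * K * dist (effects k.rev θ) (effects k.rev θ') := by
  refine D.abs_blockAverage_sub_le k hg hB fun z => (hgK _ _).trans ?_
  rw [mul_comm (D.blockRate c k) K, mul_assoc]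
  gcongr
  exact D.dist_effects_blockUpdate_le hτ hf ht hocc θ θ' z

lemma abs_blockAverage_sub_le_of_lipschitzWith {K : ℝ≥0} (hgK : LipschitzWith K g)
    (θ θ' : State I) :
    |D.blockAverage k g θ - D.blockAverage k g θ'| ≤
      K * dist (effects k.rev θ) (effects k.rev θ') :=
  D.abs_blockAverage_sub_le k hg hB fun z => (hgK.dist_le_mul _ _).trans <|
    mul_le_mul_of_nonneg_left (D.dist_blockUpdate_le hτ hf ht hocc θ θ' z) K.2

end Contraction

/-! ### Rate of convergence of the sampler -/

lemma integrable_effectEnergy (D : Model I N) (hτ : 0 < D.τ) (hf : ∀ k, 0 < D.τf k)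
    (ht : 0 ≤ D.tpr) (hN : 0 < N) : Integrable D.effectEnergy D.posterior := by
  refine ⟨D.measurable_effectEnergy.aestronglyMeasurable, ?_⟩
  rw [hasFiniteIntegral_iff_ofReal
    (Filter.Eventually.of_forall fun θ => D.effectEnergy_nonneg hf θ)]
  exact D.lintegral_effectEnergy_posterior_lt_top hτ hf ht hN

lemma memLp_effects (D : Model I N) (hτ : 0 < D.τ) (hf : ∀ k, 0 < D.τf k) (ht : 0 ≤ D.tpr)
    (hN : 0 < N) (k : Fin 2) : MemLp (effects k) 2 D.posterior := by
  have hmeas : Measurable (effects k : State I → EuclideanSpace ℝ (Fin I)) := by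
    unfold effects
    fun_prop
  rw [memLp_two_iff_integrable_sq_norm hmeas.aestronglyMeasurable]
  refine ((D.integrable_effectEnergy hτ hf ht hN).const_mul (D.τf k)⁻¹).mono'
    (hmeas.norm.pow_const 2).aestronglyMeasurable (Filter.Eventually.of_forall fun θ => ?_)
  rw [Real.norm_of_nonneg (sq_nonneg _), le_inv_mul_iff₀ (hf k), EuclideanSpace.real_norm_sq_eq,
    Finset.mul_sum]
  exact Finset.single_le_sum (f := fun k => ∑ i, D.τf k * θ.2 k i ^ 2)
    (fun k _ => Finset.sum_nonneg fun i _ => mul_nonneg (hf k).le (sq_nonneg _))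
    (Finset.mem_univ k)

/-- The bound on the rate of convergence of the sampler if all levels have `c` observations. -/
noncomputable def gibbsRate (D : Model I N) (c : ℕ) : ℝ := D.blockRate c 0 * D.blockRate c 1

lemma gibbsRate_pos (D : Model I N) (hτ : 0 < D.τ) (hf : ∀ k, 0 < D.τf k) {c : ℕ} (hc : 0 < c) :
    0 < D.gibbsRate c := by
  have hrate (k) : 0 < D.blockRate c k := by
    have := hf k
    unfold blockRate
    positivity
  exact mul_pos (hrate 0) (hrate 1)

lemma l2Proj_bot_l2Proj (D : Model I N) [IsFiniteMeasure D.posterior] (k : Fin 2)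
    (F : Lp ℝ 2 D.posterior) :
    l2Proj D.posterior bot_le (l2Proj D.posterior (keptSigma_le k) F) =
      l2Proj D.posterior bot_le F :=
  congrArg (fun T : Lp ℝ 2 D.posterior →L[ℝ] Lp ℝ 2 D.posterior => T F)
    (l2Proj_mul_of_le (bot_le : ⊥ ≤ keptSigma I k) (keptSigma_le k))

lemma l2Proj_bot_gibbsOp_pow (D : Model I N) [IsFiniteMeasure D.posterior] (t : ℕ)
    (F : Lp ℝ 2 D.posterior) :
    l2Proj D.posterior bot_le ((D.gibbsOp ^ t) F) = l2Proj D.posterior bot_le F := by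
  induction t with
  | zero => rfl
  | succ t ih =>
    rw [pow_succ', ← ih]
    exact (D.l2Proj_bot_l2Proj 0 _).trans (D.l2Proj_bot_l2Proj 1 _)

lemma pos_of_occ_eq (D : Model I N) (hN : 0 < N) {c : ℕ} (hocc : ∀ k i, D.occ k i = c) :
    0 < c := by
  rw [D.numObs_eq_mul_of_occ_eq hocc] at hN
  exact Nat.pos_of_mul_pos_left hN

section Balanced

variable (D : Model I N) (hτ : 0 < D.τ) (hf : ∀ k, 0 < D.τf k) (ht : 0 ≤ D.tpr) (hN : 0 < N)
  {c : ℕ} (hocc : ∀ k i, D.occ k i = c)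

include hτ hf ht hN hocc

lemma exists_lipschitz_gibbsOp_pow [IsFiniteMeasure D.posterior] {g : State I → ℝ}
    (hg : Measurable g) {B : ℝ} (hB : ∀ θ, |g θ| ≤ B) {K : ℝ≥0} (hgK : LipschitzWith K g)
    {F : Lp ℝ 2 D.posterior} (hFg : F =ᵐ[D.posterior] g) (t : ℕ) :
    ∃ h : State I → ℝ, Measurable h ∧ (∀ θ, |h θ| ≤ B) ∧
      (∀ θ θ', |h θ - h θ'| ≤ K * D.gibbsRate c ^ t * dist (effects 1 θ) (effects 1 θ')) ∧
      (D.gibbsOp ^ t) (l2Proj D.posterior (keptSigma_le 0) F) =ᵐ[D.posterior] h := by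
  have hD := D.nondegenerate_of_pos hτ hf ht hN
  have hrate (k) : 0 ≤ D.blockRate c k := D.blockRate_nonneg hτ.le (hf k).le c
  induction t with
  | zero =>
    refine ⟨D.blockAverage 0 g, D.measurable_blockAverage 0 hg, D.abs_blockAverage_le 0 hB, ?_,
      D.l2Proj_ae_eq_blockAverage 0 hD hg hFg⟩
    rw [pow_zero, mul_one]
    exact D.abs_blockAverage_sub_le_of_lipschitzWith hτ.le (hf 0).le ht hocc hg hB hgK
  | succ t ih =>
    obtain ⟨h, hmeas, hbound, hlip, hae⟩ := ih
    have hK : 0 ≤ K * D.gibbsRate c ^ t :=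
      mul_nonneg K.2 (pow_nonneg (mul_nonneg (hrate 0) (hrate 1)) t)
    have hmeas₁ := D.measurable_blockAverage 1 hmeas
    have hbound₁ := D.abs_blockAverage_le 1 hbound
    have hlip₁ := D.abs_blockAverage_sub_le_of_lipschitz_effects hτ.le (hf 1).le ht hocc hmeas
      hbound hK hlip
    refine ⟨D.blockAverage 0 (D.blockAverage 1 h), D.measurable_blockAverage 0 hmeas₁,
      D.abs_blockAverage_le 0 hbound₁, fun θ θ' => ?_, ?_⟩
    · have hlip₀ := D.abs_blockAverage_sub_le_of_lipschitz_effects hτ.le (hf 0).le ht hocc hmeas₁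
        hbound₁ (mul_nonneg (hrate 1) hK) hlip₁ θ θ'
      have hfactor : K * D.gibbsRate c ^ (t + 1) =
          D.blockRate c 0 * (D.blockRate c 1 * (K * D.gibbsRate c ^ t)) := by
        rw [pow_succ, gibbsRate]
        ring
      rwa [hfactor]
    · rw [pow_succ']
      exact D.l2Proj_ae_eq_blockAverage 0 hD hmeas₁ (D.l2Proj_ae_eq_blockAverage 1 hD hmeas hae)

lemma gibbsOp_decay_of_smooth [IsProbabilityMeasure D.posterior] {g : State I → ℝ}
    (hgs : HasCompactSupport g) (hgd : ContDiff ℝ (⊤ : ℕ∞) g) {F : Lp ℝ 2 D.posterior}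
    (hFg : F =ᵐ[D.posterior] g) :
    ∃ C : ℝ, ∀ t : ℕ, ‖(D.gibbsOp ^ t) (l2Proj D.posterior (keptSigma_le 0) F) -
      l2Proj D.posterior bot_le F‖ ≤ C * D.gibbsRate c ^ t := by
  obtain ⟨B, hB⟩ := hgs.exists_bound_of_continuous hgd.continuous
  obtain ⟨K, hK⟩ := ContDiff.lipschitzWith_of_hasCompactSupport hgs hgd (by simp)
  have hrate : 0 ≤ D.gibbsRate c :=
    mul_nonneg (D.blockRate_nonneg hτ.le (hf 0).le c) (D.blockRate_nonneg hτ.le (hf 1).le c)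
  have heffects := D.memLp_effects hτ hf ht hN 1
  refine ⟨K * ‖(heffects.norm.add (memLp_const (∫ θ, ‖effects 1 θ‖ ∂D.posterior))).toLp _‖,
    fun t => ?_⟩
  obtain ⟨h, -, -, hlip, hae⟩ := D.exists_lipschitz_gibbsOp_pow hτ hf ht hN hocc
    hgd.continuous.measurable hB hK hFg t
  rw [← D.l2Proj_bot_l2Proj 0 F, ← D.l2Proj_bot_gibbsOp_pow t, mul_right_comm]
  exact norm_sub_l2Proj_bot_le heffects hae (mul_nonneg K.2 (pow_nonneg hrate t)) hlip

lemma gibbsOp_decay [IsProbabilityMeasure D.posterior] (F : Lp ℝ 2 D.posterior) :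
    ∃ C : ℝ, 0 ≤ C ∧ ∀ t : ℕ, ‖(D.gibbsOp ^ t) F - l2Proj D.posterior bot_le F‖ ≤
      C * D.gibbsRate c ^ t := by
  have hc := D.pos_of_occ_eq hN hocc
  refine alternating_projections_decay (isSymmetric_l2Proj _) (isSymmetric_l2Proj _)
    (isSymmetric_l2Proj _) (isIdempotentElem_l2Proj _) (isIdempotentElem_l2Proj _)
    (l2Proj_mul_of_le (bot_le : ⊥ ≤ keptSigma I 0) (keptSigma_le 0))
    (l2Proj_mul_of_le (bot_le : ⊥ ≤ keptSigma I 1) (keptSigma_le 1)) (D.gibbsRate_pos hτ hf hc)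
    (Lp.dense_hasCompactSupport_contDiff (F := ℝ) (μ := D.posterior) (p := 2) (by simp)) ?_ F
  rintro G ⟨g, hGg, hgs, hgd⟩
  exact D.gibbsOp_decay_of_smooth hτ hf ht hN hocc hgs hgd hGg

lemma l2Rate_gibbsKernel_le :
    l2Rate D.gibbsKernel D.posterior ≤ ENNReal.ofReal (D.gibbsRate c) := by
  have := D.isProbabilityMeasure_posterior hτ hf ht hN
  have hrate := D.gibbsRate_pos hτ hf (D.pos_of_occ_eq hN hocc)
  refine sInf_le ⟨(D.gibbsRate c).toNNReal, rfl, fun f hfm => ?_⟩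
  obtain ⟨C, hC0, hC⟩ := D.gibbsOp_decay hτ hf ht hN hocc (hfm.toLp f)
  refine ⟨C.toNNReal, fun t => ?_⟩
  set Y := (D.gibbsOp ^ t) (hfm.toLp f)
  set Z := l2Proj D.posterior bot_le (hfm.toLp f)
  have herror : (fun x => kernelIter D.gibbsKernel f t x - ∫ y, f y ∂D.posterior)
      =ᵐ[D.posterior] (Y - Z : Lp ℝ 2 D.posterior) := by
    filter_upwards [Lp.coeFn_sub Y Z, D.kernelIter_gibbsKernel_ae_eq hfm t,
      l2Proj_bot_ae_eq (hfm.toLp f)] with θ hsub hiter hmean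
    rw [hsub, Pi.sub_apply, hiter, hmean, integral_congr_ae hfm.coeFn_toLp]
  rw [eLpNorm_congr_ae herror, ← Lp.enorm_def, ← ofReal_norm]
  refine (ENNReal.ofReal_le_ofReal (hC t)).trans_eq ?_
  rw [ENNReal.ofReal_mul hC0, ENNReal.ofReal_pow hrate.le]
  rfl

lemma relaxationTime_gibbsKernel_le :
    relaxationTime D.gibbsKernel D.posterior ≤ ENNReal.ofReal (1 + D.τ / D.τf 0 * c) := by
  have hf₀ := hf 0
  have hrate₀ := D.blockRate_nonneg hτ.le hf₀.le c
  have hle : D.gibbsRate c ≤ D.blockRate c 0 :=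
    mul_le_of_le_one_right hrate₀ (D.blockRate_le_one hτ.le (hf 1).le c)
  have hrate : l2Rate D.gibbsKernel D.posterior ≤ ENNReal.ofReal (D.blockRate c 0) :=
    (D.l2Rate_gibbsKernel_le hτ hf ht hN hocc).trans (ENNReal.ofReal_le_ofReal hle)
  have hgap : 1 - D.blockRate c 0 = (1 + D.τ / D.τf 0 * c)⁻¹ := by
    rw [blockRate]
    field_simp
    ring
  rw [relaxationTime, ENNReal.inv_le_iff_inv_le, ← ENNReal.ofReal_inv_of_pos (by positivity),
    ← hgap, ENNReal.ofReal_sub _ hrate₀, ENNReal.ofReal_one]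
  exact tsub_le_tsub_left hrate 1

end Balanced

lemma costGibbs_le (D : Model I N) (hτ : 0 < D.τ) (hf : ∀ k, 0 < D.τf k) (ht : 0 ≤ D.tpr)
    (hI : 3 ≤ I) {c : ℕ} (hc : 3 ≤ c) (hocc : ∀ k i, D.occ k i = c) :
    D.costGibbs ≤ ENNReal.ofReal (10 * (1 + D.τ / D.τf 0) * (D.p * D.nbar ^ 2)) := by
  have hNc := D.numObs_eq_mul_of_occ_eq hocc
  have hN : 0 < N := by rw [hNc]; positivity
  have hf₀ := hf 0
  have hc' : (3 : ℝ) ≤ c := by exact_mod_cast hc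
  have hI' : (3 : ℝ) ≤ I := by exact_mod_cast hI
  have hiteration : ((2 * (3 * N + 18 * I + 6) : ℕ) : ℝ) ≤ 20 * (I * c) := by
    rw [hNc]
    push_cast
    nlinarith
  have hrelax : 1 + D.τ / D.τf 0 * c ≤ (1 + D.τ / D.τf 0) * c := by linarith
  rw [costGibbs, costPerIteration_eq, D.nbar_eq_of_occ_eq (by omega) hocc, p]
  refine (mul_le_mul_right (D.relaxationTime_gibbsKernel_le hτ hf ht hN hocc) _).trans ?_
  rw [← ENNReal.ofReal_natCast, ← ENNReal.ofReal_mul (Nat.cast_nonneg _)]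
  refine ENNReal.ofReal_le_ofReal ?_
  calc _ ≤ 20 * (I * c) * ((1 + D.τ / D.τf 0) * c) := by gcongr
    _ = _ := by ring

end Model

end CrossedEffects

theorem mainTheorem6 :
    ∃ c C : ℝ, 0 < c ∧ 0 < C ∧
      ∀ (τ : ℝ) (τf : Fin 2 → ℝ), 0 < τ → (∀ k, 0 < τf k) →
        ∃ Cγ : ℝ, 0 < Cγ ∧
          ∀ (d I N : ℕ), 2 ≤ d → d + 1 ≤ I →
            ∀ D : CrossedEffects.Model I N,
              D.τ = τ → D.τf = τf → 0 ≤ D.tpr →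
              (∀ i j, D.cooc i j = CrossedEffects.worstDesign d I i j) →
                (D.BalancedLevels ∧ D.nbar = d + 1) ∧
                (c * (D.p * D.nbar) ≤ CrossedEffects.nQ D.precision ∧
                  CrossedEffects.nQ D.precision ≤ C * (D.p * D.nbar)) ∧
                (c * D.p ^ 2 ≤ CrossedEffects.nL D.precision ∧
                  CrossedEffects.nL D.precision ≤ C * D.p ^ 2) ∧
                (c * D.p ^ 3 ≤ CrossedEffects.costSLA D.precision ∧
                  CrossedEffects.costSLA D.precision ≤ C * D.p ^ 3) ∧
                D.ProgramExact ∧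
                D.costGibbs ≤ ENNReal.ofReal (Cγ * (D.p * D.nbar ^ 2)) := by
  refine ⟨1 / 200, 6, by norm_num, by norm_num, fun τ τf hτ hf => ?_⟩
  have hf₀ := hf 0
  refine ⟨10 * (1 + τ / τf 0), by positivity, ?_⟩
  rintro d I N hd hI D rfl rfl ht hdesign
  have hocc := D.occ_eq_of_worstDesign (by omega) hI hdesign
  have hN : 0 < N := by
    rw [D.numObs_eq_mul_of_occ_eq hocc]
    exact Nat.mul_pos (by omega) (by omega)
  have hnbar : D.nbar = d + 1 := by exact_mod_cast D.nbar_eq_of_occ_eq (by omega) hocc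
  have hpn : 0 ≤ D.p * D.nbar := by rw [hnbar, CrossedEffects.Model.p]; positivity
  obtain ⟨hQ, hQ'⟩ := D.nQ_precision_bounds hτ hd hI hdesign
  obtain ⟨hL, hL'⟩ := D.nL_precision_bounds hτ hd hI hdesign
  obtain ⟨hS, hS'⟩ := D.costSLA_precision_bounds hτ hd hI hdesign
  refine ⟨⟨D.balancedLevels_of_occ_eq hocc, hnbar⟩, ⟨?_, ?_⟩, ⟨?_, ?_⟩, ⟨hS, hS'⟩,
    D.programExact (D.nondegenerate_of_pos hτ hf ht hN),
    D.costGibbs_le hτ hf ht (by omega) (by omega) hocc⟩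
  · linarith
  · linarith
  · nlinarith [sq_nonneg D.p]
  · nlinarith [sq_nonneg D.p]
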